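/- Throughout, rings are commutative with unit, and $m,n\geqslant 1$ are integers. For a ring $A$ put $\mathcal L^n(A)=A((t_1))\ldots((t_n))$, the ring of iterated Laurent series. Let $\Lambda_n$ be the set of all $\lambda=(\lambda_1,\ldots,\lambda_n)$ with $\lambda_p\colon\mathbb Z^{n-p}\to\mathbb Z$ for $p<n$ and $\lambda_n\in\mathbb Z$, and put $\mathbb Z^n_\lambda=\{l\in\mathbb Z^n\mid l_n\geqslant\lambda_n,\ l_{n-1}\geqslant\lambda_{n-1}(l_n),\ \ldots,\ l_1\geqslant\lambda_1(l_2,\ldots,l_n)\}$. Thus $\mathcal L^n(A)$ consists of all series $\sum_{l\in\mathbb Z^n}a_lt^l$, $a_l\in A$, with support contained in some $\mathbb Z^n_\lambda$. Give $\mathcal L^n(A)$ the translation-invariant topology in which the subgroups $U_\lambda=\{f\mid \mathrm{supp}(f)\cap(-\mathbb Z^n_\lambda)=\varnothing\}$, $\lambda\in\Lambda_n$, form a base of neighbourhoods of zero, and let $\mathrm{Hom}^{\rm c,alg}_A(\mathcal L^n(A),\mathcal L^m(A))$ be the set of continuous homomorphisms of $A$-algebras. Order $\mathbb Z^n$ lexicographically,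 the last coordinate being the most significant one. Let $\underline{\mathbb Z}(A)$ be the group of locally constant functions $\mathrm{Spec}(A)\to\mathbb Z$. For $f=\sum_l a_lt^l\in\mathcal L^n(A)^*$ let $\nu(f)\in\underline{\mathbb Z}^n(A)$ be the locally constant function whose value at a prime $\mathfrak p$ is the smallest $l$ with $a_l\notin\mathfrak p$; let $(L^m\mathbb G_m)^0(A)$ be the kernel of the homomorphism $\nu\colon\mathcal L^m(A)^*\to\underline{\mathbb Z}^m(A)$. For $v\in\underline{\mathbb Z}^m(A)$ let $t^v\in\mathcal L^m(A)$ be the element equal to $t^{l_i}$ over $A_i$, for any finite decomposition $A=\prod_iA_i$ such that $v$ is constant with value $l_i$ on $\mathrm{Spec}(A_i)$. Let $\mathrm M^+_{m\times n}(\mathbb Z)$ be the set of integral $m\times n$-matrices $M$ such that $l>0$ implies $M\cdot l>0$ for all $l\in\mathbb Z^n$, and let $\mathrm M^+_{m\times n}(\underline{\mathbb Z})(A)=\mathrm M^+_{m\times n}(\underline{\mathbb Z}(A))$ be the set of $m\times n$-matrices over $\underline{\mathbb Z}(A)$ that belong to $\mathrm M^+_{m\times n}(\mathbb Z)$ at every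 point of $\mathrm{Spec}(A)$. For $\phi\in\mathrm{Hom}^{\rm c,alg}_A(\mathcal L^n(A),\mathcal L^m(A))$ let $\Upsilon(\phi)$ be the matrix over $\underline{\mathbb Z}(A)$ with columns $\nu(\phi(t_1)),\ldots,\nu(\phi(t_n))$. **Proposition.** For any ring homomorphism $A\to B$ and any $\phi\in\mathrm{Hom}^{\rm c,alg}_A(\mathcal L^n(A),\mathcal L^m(A))$ there is a unique $\phi_B\in\mathrm{Hom}^{\rm c,alg}_B(\mathcal L^n(B),\mathcal L^m(B))$ compatible with $\phi$ under the natural maps $\mathcal L^n(A)\to\mathcal L^n(B)$ and $\mathcal L^m(A)\to\mathcal L^m(B)$; thus $A\mapsto \mathrm{Hom}^{\rm c,alg}_A(\mathcal L^n(A),\mathcal L^m(A))$ is a functor on the category of rings. The functor $$\mathrm M^+_{m\times n}(\underline{\mathbb Z})\times\big((L^m\mathbb G_m)^0\big)^{\times n}$$ is an ind-affine scheme over $\mathbb Z$, that is, the colimit of the functors of points of a directed system of affine schemes whose transition maps are closed embeddings. This ind-affine scheme represents the functor $A\mapsto \mathrm{Hom}^{\rm c,alg}_A(\mathcal L^n(A),\mathcal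 L^m(A))$: there is an isomorphism of functors which for any ring $A$ sends $\phi\in\mathrm{Hom}^{\rm c,alg}_A(\mathcal L^n(A),\mathcal L^m(A))$ to $$\big(\Upsilon(\phi),(f_1,\ldots,f_n)\big),\qquad f_i=\phi(t_i)\cdot t^{-\nu(\phi(t_i))},\quad 1\leqslant i\leqslant n.$$ -/

import Mathlib

open CategoryTheory Matrix

universe u

namespace IterLaurent

/-! ## Exponents and supports -/

/-- The group `ℤⁿ` of exponents; it carries the lexicographical order in which the **last**
coordinate is the most significant one. -/
def Expo (n : ℕ) : Type := Fin n → ℤ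

/-- An exponent as a vector of integers, and conversely. -/
def vec {n : ℕ} : Expo n ≃ (Fin n → ℤ) := Equiv.refl _

instance (n : ℕ) : AddCommGroup (Expo n) := inferInstanceAs (AddCommGroup (Fin n → ℤ))

noncomputable instance (n : ℕ) : LinearOrder (Expo n) :=
  inferInstanceAs (LinearOrder (Colex (Fin n → ℤ)))

@[simp] theorem vec_add {n : ℕ} (a b : Expo n) : vec (a + b) = vec a + vec b := rfl
@[simp] theorem vec_neg {n : ℕ} (a : Expo n) : vec (-a) = -vec a := rfl
@[simp] theorem vec_zero {n : ℕ} : vec (0 : Expo n) = 0 := rfl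

/-- The order on exponents: compare the last coordinates in which they differ. -/
theorem expo_lt_iff {n : ℕ} (a b : Expo n) :
    a < b ↔ ∃ i, (∀ j, i < j → vec a j = vec b j) ∧ vec a i < vec b i := Iff.rfl

instance (n : ℕ) : IsOrderedAddMonoid (Expo n) where
  add_le_add_left a b hab c := by
    rcases hab.lt_or_eq with hlt | rfl
    · rw [expo_lt_iff] at hlt
      obtain ⟨i, hi, hi'⟩ := hlt
      refine le_of_lt ((expo_lt_iff _ _).2 ⟨i, fun j hj => ?_, ?_⟩)
      · simp [hi j hj]
      · simpa using hi'
    · exact le_rfl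

/-- `Λₙ`: families `(λ₁, …, λₙ)`, where `λ_p` is an integral valued function of the coordinates
with indices `q > p` (so `λₙ` is just an integer). -/
abbrev Lam (n : ℕ) : Type := (p : Fin n) → ({q : Fin n // p < q} → ℤ) → ℤ

/-- `ℤⁿ_λ`: the set of all `l` with `l_p ≥ λ_p(l_{p+1}, …, l_n)` for all `p`. -/
def ZLam {n : ℕ} (lam : Lam n) : Set (Expo n) :=
  {l | ∀ p : Fin n, lam p (fun q => vec l q.1) ≤ vec l p}

theorem vec_le_of_le {n : ℕ} {a b : Expo n} (hab : a ≤ b) (i : Fin n)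
    (h : ∀ j, i < j → vec a j = vec b j) : vec a i ≤ vec b i := by
  by_contra! hlt
  exact absurd hab (not_le.2 ((expo_lt_iff _ _).2 ⟨i, fun j hj => (h j hj).symm, hlt⟩))

theorem isWF_ZLam {n : ℕ} (lam : Lam n) : (ZLam lam).IsWF := by
  rw [Set.isWF_iff_no_descending_seq]
  intro x hx hmem
  have key : ∀ i : Fin n, ∃ K, ∀ k, K ≤ k → vec (x k) i = vec (x K) i := by
    intro i
    induction i using WellFoundedGT.induction with
    | ind i ih =>
      choose! K hK using ih
      let N := Finset.univ.sup K
      have hN : ∀ j, i < j → ∀ k, N ≤ k → vec (x k) j = vec (x N) j := by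
        intro j hj k hk
        have hKN : K j ≤ N := Finset.le_sup (Finset.mem_univ j)
        rw [hK j hj k (hKN.trans hk), hK j hj N hKN]
      have hanti : ∀ k k', N ≤ k → k ≤ k' → vec (x k') i ≤ vec (x k) i := fun k k' hk hkk' =>
        vec_le_of_le (hx.antitone hkk') i fun j hj => by rw [hN j hj k hk, hN j hj k' (hk.trans hkk')]
      have hbdd : ∀ k, N ≤ k → lam i (fun q => vec (x N) q.1) ≤ vec (x k) i := by
        intro k hk
        have h := hmem k i
        have e : (fun q : {q : Fin n // i < q} => vec (x k) q.1) = fun q => vec (x N) q.1 :=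
          funext fun q => hN q.1 q.2 k hk
        rwa [e] at h
      obtain ⟨y, ⟨k, hk, rfl⟩, hmin⟩ := Int.exists_least_of_bdd
        (P := fun z => ∃ k, N ≤ k ∧ vec (x k) i = z) ⟨_, by rintro z ⟨k, hk, rfl⟩; exact hbdd k hk⟩
        ⟨_, N, le_rfl, rfl⟩
      exact ⟨k, fun k' hk' => le_antisymm (hanti k k' hk hk') (hmin _ ⟨k', hk.trans hk', rfl⟩)⟩
  choose K hK using key
  have hne : x (Finset.univ.sup K + 1) = x (Finset.univ.sup K) := by
    apply vec.injective
    funext i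
    have h : K i ≤ Finset.univ.sup K := Finset.le_sup (Finset.mem_univ i)
    rw [hK i _ (h.trans (Nat.le_succ _)), hK i _ h]
  exact (hx (Nat.lt_succ_self (Finset.univ.sup K))).ne hne

/-- A set of exponents is well-ordered for the lexicographical order if and only if it is contained
in `ℤⁿ_λ` for some `λ`. -/
theorem isPWO_iff_exists_subset_ZLam {n : ℕ} (X : Set (Expo n)) :
    X.IsPWO ↔ ∃ lam : Lam n, X ⊆ ZLam lam := by
  classical
  constructor
  · intro hX
    let S : (p : Fin n) → ({q : Fin n // p < q} → ℤ) → Set (Expo n) :=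
      fun p c => {l | l ∈ X ∧ ∀ q, vec l q.1 = c q}
    have hSX : ∀ p c, (S p c).IsWF := fun p c =>
      (hX.mono (fun l (hl : l ∈ S p c) => hl.1)).isWF
    refine ⟨fun p c => if h : (S p c).Nonempty then
      vec ((hSX p c).min h) p else 0, fun l hl p => ?_⟩
    have hlS : l ∈ S p fun q => vec l q.1 := ⟨hl, fun _ => rfl⟩
    have hne : (S p fun q => vec l q.1).Nonempty := ⟨l, hlS⟩
    have hwf := hSX p fun q => vec l q.1
    change (if h : (S p fun q => vec l q.1).Nonempty then _ else _) ≤ _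
    rw [dif_pos hne]
    exact vec_le_of_le (hwf.min_le hne hlS) p fun j hj => (hwf.min_mem hne).2 ⟨j, hj⟩
  · rintro ⟨lam, h⟩
    exact (isWF_ZLam lam).isPWO.mono h

/-! ## The ring of iterated Laurent series and its topology -/

/-- The ring `A((t₁))⋯((tₙ))` of iterated Laurent series. It consists of all series
`∑ a_l t^l` whose support is contained in `ℤⁿ_λ` for some `λ`; by `isPWO_iff_exists_subset_ZLam`
these are exactly the Hahn series for the lexicographical order (last coordinate most significant).
The product is the convolution product. -/
abbrev Ser (n : ℕ) (A : Type u) [CommRing A] : Type u := HahnSeries (Expo n) A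

/-- Iterated Laurent series are the series supported in some `ℤⁿ_λ`. -/
theorem exists_ser_coeff_eq_iff {n : ℕ} {A : Type u} [CommRing A] (a : Expo n → A) :
    (∃ f : Ser n A, f.coeff = a) ↔ ∃ lam : Lam n, Function.support a ⊆ ZLam lam := by
  rw [← isPWO_iff_exists_subset_ZLam]
  exact ⟨fun ⟨f, hf⟩ => hf ▸ f.isPWO_support, fun h => ⟨⟨a, h⟩, rfl⟩⟩

/-- `U_λ`: the series whose support does not meet `-ℤⁿ_λ`. -/
def USet {n : ℕ} (A : Type u) [CommRing A] (lam : Lam n) : Set (Ser n A) :=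
  {f | ∀ l ∈ ZLam lam, f.coeff (-l) = 0}

theorem USet_inf_subset {n : ℕ} {A : Type u} [CommRing A] (lam mu : Lam n) :
    USet A (lam ⊓ mu) ⊆ USet A lam ∩ USet A mu :=
  fun _ hf => ⟨fun l hl => hf l fun p => inf_le_left.trans (hl p),
    fun l hl => hf l fun p => inf_le_right.trans (hl p)⟩

/-- The topology on `A((t₁))⋯((tₙ))` invariant under translations such that the sets `U_λ` form a
base of neighbourhoods of zero. -/
instance serTopology (n : ℕ) (A : Type u) [CommRing A] : TopologicalSpace (Ser n A) where
  IsOpen S := ∀ f ∈ S, ∃ lam : Lam n, ∀ g ∈ USet A lam, f + g ∈ S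
  isOpen_univ := fun _ _ => ⟨0, fun _ _ => trivial⟩
  isOpen_inter := fun S T hS hT f hf => by
    obtain ⟨lam, hlam⟩ := hS f hf.1
    obtain ⟨mu, hmu⟩ := hT f hf.2
    exact ⟨lam ⊓ mu, fun g hg => ⟨hlam g (USet_inf_subset lam mu hg).1,
      hmu g (USet_inf_subset lam mu hg).2⟩⟩
  isOpen_sUnion := fun S hS f ⟨T, hT, hfT⟩ => by
    obtain ⟨lam, hlam⟩ := hS T hT f hfT
    exact ⟨lam, fun g hg => ⟨T, hT, hlam g hg⟩⟩

/-- The sets `U_λ` form a base of neighbourhoods of zero. -/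
theorem hasBasis_nhds_zero (n : ℕ) (A : Type u) [CommRing A] :
    (nhds (0 : Ser n A)).HasBasis (fun _ : Lam n => True) (USet A) := by
  refine ⟨fun S => ?_⟩
  rw [mem_nhds_iff]
  constructor
  · rintro ⟨T, hTS, hT, h0⟩
    obtain ⟨lam, hlam⟩ := hT 0 h0
    exact ⟨lam, trivial, fun g hg => hTS (by simpa using hlam g hg)⟩
  · rintro ⟨lam, -, h⟩
    refine ⟨USet A lam, h, fun f hf => ⟨lam, fun g hg l hl => ?_⟩, fun l _ => rfl⟩
    rw [HahnSeries.coeff_add, hf l hl, hg l hl, add_zero]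

/-- The ring homomorphism `A((t₁))⋯((tₙ)) → B((t₁))⋯((tₙ))` obtained by applying a ring
homomorphism `A → B` to the coefficients. -/
noncomputable def serMap (n : ℕ) {A B : Type u} [CommRing A] [CommRing B] (g : A →+* B) :
    Ser n A →+* Ser n B where
  toFun f := f.map g
  map_one' := HahnSeries.map_one g.toMonoidWithZeroHom
  map_mul' _ _ := HahnSeries.map_mul (g : A →ₙ+* B)
  map_zero' := by ext; simp
  map_add' _ _ := by ext; simp

@[simp]
theorem serMap_coeff (n : ℕ) {A B : Type u} [CommRing A] [CommRing B] (g : A →+* B)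
    (f : Ser n A) (l : Expo n) : (serMap n g f).coeff l = g (f.coeff l) := rfl

/-- The variable `t_i`, as an invertible element of `A((t₁))⋯((tₙ))`. -/
noncomputable def tvar {n : ℕ} (A : Type u) [CommRing A] (i : Fin n) : (Ser n A)ˣ where
  val := HahnSeries.single (vec.symm (Pi.single i 1)) 1
  inv := HahnSeries.single (-vec.symm (Pi.single i 1)) 1
  val_inv := by rw [HahnSeries.single_mul_single, add_neg_cancel, one_mul]; rfl
  inv_val := by rw [HahnSeries.single_mul_single, neg_add_cancel, one_mul]; rfl

/-! ## The valuation -/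

/-- The lexicographically smallest exponent `l` with `a_l ∉ 𝔭`, for an iterated Laurent series
`∑ a_l t^l` and a prime ideal `𝔭` (and `0` if there is no such exponent). -/
noncomputable def nuAt {n : ℕ} {A : Type u} [CommRing A] (f : Ser n A) (p : PrimeSpectrum A) :
    Expo n :=
  (serMap n (Ideal.Quotient.mk p.asIdeal) f).order

theorem serMap_unit_ne_zero {n : ℕ} {A B : Type u} [CommRing A] [CommRing B] [Nontrivial B]
    (g : A →+* B) (f : (Ser n A)ˣ) : serMap n g f ≠ 0 :=
  (f.isUnit.map (serMap n g)).ne_zero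

/-- For an invertible `f` the value of `nuAt` is characterized by the conditions that all
coefficients with smaller exponents are in `𝔭` and that the corresponding coefficient is not. -/
theorem nuAt_eq_iff {n : ℕ} {A : Type u} [CommRing A] (f : (Ser n A)ˣ) (p : PrimeSpectrum A)
    (l : Expo n) :
    nuAt (f : Ser n A) p = l ↔
      (∀ l' < l, (f : Ser n A).coeff l' ∈ p.asIdeal) ∧ (f : Ser n A).coeff l ∉ p.asIdeal := by
  have h0 := serMap_unit_ne_zero (Ideal.Quotient.mk p.asIdeal) f
  have hmem : ∀ l, (f : Ser n A).coeff l ∈ p.asIdeal ↔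
      (serMap n (Ideal.Quotient.mk p.asIdeal) f).coeff l = 0 := fun l => by
    rw [serMap_coeff, Ideal.Quotient.eq_zero_iff_mem]
  simp only [hmem, nuAt]
  constructor
  · rintro rfl
    exact ⟨fun l' hl' => HahnSeries.coeff_eq_zero_of_lt_order hl',
      fun h => h0 (HahnSeries.coeff_order_eq_zero.1 h)⟩
  · rintro ⟨h1, h2⟩
    refine le_antisymm (HahnSeries.order_le_of_coeff_ne_zero h2) ?_
    by_contra! hlt
    exact h0 (HahnSeries.coeff_order_eq_zero.1 (h1 _ hlt))

theorem nuAt_le {n : ℕ} {A : Type u} [CommRing A] (f : Ser n A) (p : PrimeSpectrum A)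
    (l : Expo n) (h : f.coeff l ∉ p.asIdeal) : nuAt f p ≤ l :=
  HahnSeries.order_le_of_coeff_ne_zero fun h0 =>
    h (Ideal.Quotient.eq_zero_iff_mem.1 (by simpa using h0))

theorem nuAt_mul {n : ℕ} {A : Type u} [CommRing A] (f g : (Ser n A)ˣ) (p : PrimeSpectrum A) :
    nuAt ((f * g : (Ser n A)ˣ) : Ser n A) p = nuAt (f : Ser n A) p + nuAt (g : Ser n A) p := by
  rw [nuAt, Units.val_mul, map_mul,
    HahnSeries.order_mul (serMap_unit_ne_zero _ f) (serMap_unit_ne_zero _ g)]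
  rfl

/-- The homomorphism `ν` from the group of invertible iterated Laurent series to the group of
locally constant functions on `Spec A` with values in `ℤⁿ`. Its value at a prime ideal `𝔭` is the
smallest exponent `l` such that the coefficient `a_l` is not in `𝔭`. Thus, on a clopen part
`Spec A'` of `Spec A` on which `ν(f)` is constant with value `l`, the coefficients of the image of
`f` in `A'((t₁))⋯((tₙ))` with exponents smaller than `l` are nilpotent and the coefficient with
exponent `l` is invertible. -/
noncomputable def nu {n : ℕ} {A : Type u} [CommRing A] (f : (Ser n A)ˣ) :
    LocallyConstant (PrimeSpectrum A) (Fin n → ℤ) where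
  toFun p := vec (nuAt (f : Ser n A) p)
  isLocallyConstant := by
    rw [IsLocallyConstant.iff_exists_open]
    intro p
    have hsum : ∀ q, nuAt (f : Ser n A) q + nuAt ((f⁻¹ : (Ser n A)ˣ) : Ser n A) q = 0 := by
      intro q
      rw [← nuAt_mul, mul_inv_cancel, Units.val_one, nuAt, map_one, HahnSeries.order_one]
    refine ⟨PrimeSpectrum.basicOpen ((f : Ser n A).coeff (nuAt (f : Ser n A) p) *
      ((f⁻¹ : (Ser n A)ˣ) : Ser n A).coeff (nuAt ((f⁻¹ : (Ser n A)ˣ) : Ser n A) p)),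
      TopologicalSpace.Opens.isOpen _, ?_, ?_⟩
    · exact p.2.mul_notMem ((nuAt_eq_iff f p _).1 rfl).2 ((nuAt_eq_iff f⁻¹ p _).1 rfl).2
    · intro q hq
      have hq' : (f : Ser n A).coeff (nuAt (f : Ser n A) p) *
        ((f⁻¹ : (Ser n A)ˣ) : Ser n A).coeff (nuAt ((f⁻¹ : (Ser n A)ˣ) : Ser n A) p) ∉
          q.asIdeal := hq
      have h1 := nuAt_le (f : Ser n A) q _ fun h => hq' (q.asIdeal.mul_mem_right _ h)
      have h2 := nuAt_le ((f⁻¹ : (Ser n A)ˣ) : Ser n A) q _ fun h =>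
        hq' (q.asIdeal.mul_mem_left _ h)
      refine congrArg vec (le_antisymm h1 ?_)
      rw [eq_neg_of_add_eq_zero_left (hsum p), eq_neg_of_add_eq_zero_left (hsum q)]
      exact neg_le_neg h2

theorem nu_mul {n : ℕ} {A : Type u} [CommRing A] (f g : (Ser n A)ˣ) :
    nu (f * g) = nu f + nu g := by
  ext1 p
  exact congrArg vec (nuAt_mul f g p)

/-- For a locally constant function `v` on `Spec A` with values in `ℤⁿ`, the monomial `t^v`: if
`Spec A` is the disjoint union of clopen sets `Spec Aᵢ` on which `v` is constant with value `lᵢ`, so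
`A = ∏ Aᵢ`, then `t^v` is the element `(t^{lᵢ})ᵢ`. In other words, the coefficient of `t^v` with
exponent `l` is the idempotent in `A` that corresponds to the clopen set `v = l`. -/
noncomputable def tpow {n : ℕ} {A : Type u} [CommRing A]
    (v : LocallyConstant (PrimeSpectrum A) (Fin n → ℤ)) : Ser n A where
  coeff l := (PrimeSpectrum.isIdempotentElemEquivClopens.symm
    (⟨v ⁻¹' {vec l}, v.isLocallyConstant.isClopen_fiber _⟩ :
      TopologicalSpace.Clopens (PrimeSpectrum A))).1
  isPWO_support' := by
    refine Set.Finite.isPWO (((v.range_finite).preimage vec.injective.injOn).subset ?_)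
    intro l hl
    by_contra hnot
    refine hl ?_
    have hempty : (⟨v ⁻¹' {vec l}, v.isLocallyConstant.isClopen_fiber _⟩ :
        TopologicalSpace.Clopens (PrimeSpectrum A)) = ⊥ := by
      ext p
      exact ⟨fun h => (hnot ⟨p, h⟩).elim, fun h => h.elim⟩
    simp only [hempty, map_bot]
    rfl

/-! ## The functors -/

/-- Base change for continuous homomorphisms of algebras: for any ring homomorphism
`g : A → B` and any continuous homomorphism of `A`-algebras
`φ : A((t₁))⋯((tₙ)) → A((t₁))⋯((tₘ))` there is exactly one continuous homomorphism of `B`-algebras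
`ψ : B((t₁))⋯((tₙ)) → B((t₁))⋯((tₘ))` compatible with `φ` and `g`. -/
def HasBaseChange (n m : ℕ) : Prop :=
  ∀ (A B : CommRingCat.{u}) (g : A ⟶ B) (φ : Ser n A →A[A] Ser m A),
    ∃! ψ : Ser n B →A[B] Ser m B, ∀ f : Ser n A, ψ (serMap n g.hom f) = serMap m g.hom (φ f)

/-- The functor that sends a ring `A` to the set of continuous homomorphisms of `A`-algebras
`A((t₁))⋯((tₙ)) → A((t₁))⋯((tₘ))` and a ring homomorphism to the base change along it. -/
noncomputable def homFunctor (n m : ℕ) (h : HasBaseChange.{u} n m) : CommRingCat.{u} ⥤ Type u where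
  obj A := Ser n A →A[A] Ser m A
  map {A B} g := TypeCat.ofHom fun φ => (h A B g φ).choose
  map_id A := by
    apply ConcreteCategory.hom_ext
    intro φ
    exact ((h A A (𝟙 A) φ).choose_spec.2 φ fun f => rfl).symm
  map_comp {A B C} g g' := by
    apply ConcreteCategory.hom_ext
    intro φ
    refine ((h A C (g ≫ g') φ).choose_spec.2 ((h B C g' (h A B g φ).choose).choose)
      fun f => ?_).symm
    change (h B C g' (h A B g φ).choose).choose (serMap n g'.hom (serMap n g.hom f)) =
      serMap m g'.hom (serMap m g.hom (φ f))
    rw [(h B C g' _).choose_spec.1, (h A B g φ).choose_spec.1]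

/-- Pull-back of locally constant functions on prime spectra along a ring homomorphism. -/
noncomputable def pullback {A B : Type u} [CommRing A] [CommRing B] (g : A →+* B) {X : Type}
    (v : LocallyConstant (PrimeSpectrum A) X) : LocallyConstant (PrimeSpectrum B) X :=
  v.comap ⟨PrimeSpectrum.comap g, PrimeSpectrum.continuous_comap g⟩

theorem nu_serMap {n : ℕ} {A B : Type u} [CommRing A] [CommRing B] (g : A →+* B)
    (f : (Ser n A)ˣ) : nu (Units.map (serMap n g : Ser n A →* Ser n B) f) = pullback g (nu f) := by
  ext1 q
  have h : nuAt ((Units.map (serMap n g : Ser n A →* Ser n B) f : (Ser n B)ˣ) : Ser n B) q =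
      nuAt (f : Ser n A) (PrimeSpectrum.comap g q) :=
    (nuAt_eq_iff _ q _).2 ((nuAt_eq_iff f (PrimeSpectrum.comap g q) _).1 rfl)
  exact congrArg vec h

/-- `(Lᵐ𝔾ₘ)⁰(A)`: the kernel of `ν` on the group of invertible elements of `A((t₁))⋯((tₘ))`. -/
abbrev UnitsZero (m : ℕ) (A : Type u) [CommRing A] : Type u := {f : (Ser m A)ˣ // nu f = 0}

/-- The functor `(Lᵐ𝔾ₘ)⁰`. -/
noncomputable def unitsZeroFunctor (m : ℕ) : CommRingCat.{u} ⥤ Type u where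
  obj A := UnitsZero m A
  map {A B} g := TypeCat.ofHom fun f =>
    ⟨Units.map (serMap m g.hom : Ser m A →* Ser m B) f.1, by rw [nu_serMap, f.2]; rfl⟩
  map_id _ := rfl
  map_comp _ _ := rfl

/-- The set `M⁺_{m×n}(ℤ)` of integral matrices that strictly preserve the lexicographical order. -/
def MPlus (m n : ℕ) : Set (Matrix (Fin m) (Fin n) ℤ) :=
  {M | ∀ l : Expo n, 0 < l → (0 : Expo m) < vec.symm (M *ᵥ vec l)}

/-- `M⁺_{m×n}(ℤ̲)(A)`: the set of `m × n`-matrices of locally constant functions on `Spec A` that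
belong to `M⁺_{m×n}(ℤ)` at all points of `Spec A`. -/
abbrev PlusMatrix (m n : ℕ) (A : Type u) [CommRing A] : Type u :=
  {M : Matrix (Fin m) (Fin n) (LocallyConstant (PrimeSpectrum A) ℤ) //
    ∀ p : PrimeSpectrum A, (M.map fun a => a p) ∈ MPlus m n}

/-- The functor `M⁺_{m×n}(ℤ̲)`. -/
noncomputable def plusMatrixFunctor (m n : ℕ) : CommRingCat.{u} ⥤ Type u where
  obj A := PlusMatrix m n A
  map g := TypeCat.ofHom fun M =>
    ⟨M.1.map (pullback g.hom), fun p => M.2 (PrimeSpectrum.comap g.hom p)⟩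
  map_id _ := rfl
  map_comp _ _ := rfl

/-- The functor `M⁺_{m×n}(ℤ̲) × ((Lᵐ𝔾ₘ)⁰)^{×n}`. -/
noncomputable def targetFunctor (m n : ℕ) : CommRingCat.{u} ⥤ Type u where
  obj A := PlusMatrix m n A × (Fin n → UnitsZero m A)
  map g := TypeCat.ofHom fun x =>
    ((plusMatrixFunctor m n).map g x.1, fun i => (unitsZeroFunctor m).map g (x.2 i))
  map_id _ := rfl
  map_comp _ _ := rfl

/-- A functor on the category of rings is represented by an ind-affine scheme (over `ℤ`) if it is
the colimit of the functors represented by a system of affine schemes `Spec R_j`, indexed by a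
(small, non-empty) directed set, with closed embeddings as transition maps. -/
def IsIndAffine (F : CommRingCat.{u} ⥤ Type u) : Prop :=
  ∃ (J : Type u) (_ : Preorder J) (_ : IsDirectedOrder J) (_ : Nonempty J)
    (R : J ⥤ CommRingCat.{u}ᵒᵖ),
    (∀ (i j : J) (a : i ⟶ j), Function.Surjective (R.map a).unop.hom) ∧
      Nonempty (Limits.colimit (R ⋙ coyoneda) ≅ F)

/-- The matrix `Υ(φ)` with columns `ν(φ(t₁)), …, ν(φ(tₙ))`. -/
noncomputable def upsilon {n m : ℕ} {A : Type u} [CommRing A] (φ : Ser n A →A[A] Ser m A) :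
    Matrix (Fin m) (Fin n) (LocallyConstant (PrimeSpectrum A) ℤ) :=
  Matrix.of fun j i => (nu (Units.map (φ : Ser n A →* Ser m A) (tvar A i))).map fun v => v j

end IterLaurent

namespace IterLaurent

/-! ### Continuity in terms of supports, and density of monomials. -/

section

open scoped Pointwise

/-! Finite sums of terms `a t^l` are dense, so a continuous homomorphism is determined by the images
of the variables (`addHom_ext_of_single`, `ringHom_ext_of_tvar`). The question is which tuples of
units `g_i` occur as these images.

The matrix with columns `ν(g_i)` must preserve the order. If `t^l` with `l > 0` had an image of
valuation `≤ 0` at some prime, its powers would tend to zero while their images would not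
(`nuAt_map_monomial_pos`). Conversely, write `g_i = t^{ν(g_i)} f_i` with `ν(f_i) = 0`. Where the
matrix is a constant `M`, the map should be `∑ a_l t^l ↦ ∑ a_l t^{Ml} ∏ f_i^{l_i}`. This converges
and is continuous because `M` is strictly monotone and all the products `∏ f_i^{l_i}` are supported
in one well-ordered set (`exists_isPWO_support_prod_zpow`). Idempotents glue the maps for the
finitely many values of the matrix (`exists_algHom`). Base change follows because `ν` commutes with
it.

The common support comes from the main structural fact, `unitsDecompose`: a unit with trivial
valuation is a nilpotent series plus a series with non-negative exponents. It is proved by induction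
on the number of variables, after showing that an idempotent series with nilpotent coefficients is
zero (`UnitsDecompose.idempotent_eq_zero`).

For ind-affineness, the target embeds into an affine space by means of fiber idempotents and the
coefficients of the `f_i` and `f_i⁻¹`. Bounding the set of matrices, the supports and the nilpotency
exponents cuts it into a directed union of parts. The polynomial identities valid on a part already
force a point of the affine space to come from the target (`isIndAffine_of_vanishingIdeal`). -/

theorem isPWO_preimage {α β : Type*} [LinearOrder α] [Preorder β] {f : α → β}
    (hf : StrictMono f) {s : Set β} (hs : s.IsPWO) : (f ⁻¹' s).IsPWO := by
  rw [Set.IsPWO, Set.partiallyWellOrderedOn_iff_exists_lt]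
  intro x hx
  obtain ⟨i, j, hij, h⟩ := Set.PartiallyWellOrderedOn.exists_lt hs (f := f ∘ x) hx
  exact ⟨i, j, hij, hf.le_iff_le.1 h⟩

variable {n m k : ℕ} {A B : Type u} [CommRing A] [CommRing B]

/-- Continuity at zero for the topology on iterated Laurent series, in terms of supports. -/
def ContAtZero (Φ : Ser n A → Ser m B) : Prop :=
  ∀ V : Set (Expo m), V.IsPWO → ∃ W : Set (Expo n), W.IsPWO ∧
    ∀ f : Ser n A, (∀ l ∈ W, f.coeff (-l) = 0) → ∀ l ∈ V, (Φ f).coeff (-l) = 0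

/-- Additivity reduces continuity to zero, and the sets `ZLam` are cofinal among the well-ordered
sets of exponents. Arbitrary well-ordered sets are more convenient because they are stable under
sums, unions and images. -/
theorem continuous_iff_contAtZero (Φ : Ser n A →+ Ser m B) :
    Continuous Φ ↔ ContAtZero (Φ : Ser n A → Ser m B) := by
  constructor
  · intro hΦ V hV
    obtain ⟨lam, hlam⟩ := (isPWO_iff_exists_subset_ZLam V).1 hV
    have h1 := hΦ.tendsto 0
    rw [map_zero] at h1
    obtain ⟨mu, -, hmu⟩ := ((hasBasis_nhds_zero n A).tendsto_iff (hasBasis_nhds_zero m B)).1 h1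
      lam trivial
    exact ⟨ZLam mu, (isWF_ZLam mu).isPWO, fun f hf l hl => hmu f hf l (hlam hl)⟩
  · intro h
    refine continuous_def.2 fun S hS f hf => ?_
    obtain ⟨lam, hlam⟩ := hS _ hf
    obtain ⟨W, hW, hWV⟩ := h _ (isWF_ZLam lam).isPWO
    obtain ⟨mu, hmu⟩ := (isPWO_iff_exists_subset_ZLam W).1 hW
    refine ⟨mu, fun g hg => ?_⟩
    rw [Set.mem_preimage, map_add]
    exact hlam _ (hWV g fun l hl => hg l (hmu hl))

theorem ContAtZero.comp {C : Type u} [CommRing C] {Ψ : Ser m B → Ser k C} {Φ : Ser n A → Ser m B}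
    (hΨ : ContAtZero Ψ) (hΦ : ContAtZero Φ) : ContAtZero (Ψ ∘ Φ) := by
  intro V hV
  obtain ⟨W, hW, hWV⟩ := hΨ V hV
  obtain ⟨W', hW', hWV'⟩ := hΦ W hW
  exact ⟨W', hW', fun f hf => hWV _ (hWV' f hf)⟩

theorem contAtZero_serMap (g : A →+* B) : ContAtZero (serMap n g) := fun V hV =>
  ⟨V, hV, fun f hf l hl => by rw [serMap_coeff, hf l hl, map_zero]⟩

/-- The coefficient of `x y` at `-l` involves `y` only at `-(l + i)` with `i` in the support of `x`,
so it suffices to enlarge `V` by that support. -/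
theorem contAtZero_mul_left (x : Ser n A) : ContAtZero (fun y => x * y) := by
  intro V hV
  refine ⟨V + x.support, hV.add x.isPWO_support, fun f hf l hl => ?_⟩
  rw [HahnSeries.coeff_mul]
  refine Finset.sum_eq_zero fun ij hij => ?_
  rw [Finset.mem_antidiagonal] at hij
  have h : ij.2 = -(l + ij.1) := by
    rw [neg_add, ← hij.2.2]; abel
  rw [h, hf _ (Set.add_mem_add hl hij.1), mul_zero]

theorem finite_inter_neg {s t : Set (Expo n)} (hs : s.IsPWO) (ht : t.IsPWO) :
    {l | l ∈ s ∧ -l ∈ t}.Finite := by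
  refine ((Set.AddAntidiagonal.finite_of_isPWO hs ht 0).image Prod.fst).subset ?_
  rintro l ⟨h1, h2⟩
  exact ⟨(l, -l), ⟨h1, h2, add_neg_cancel l⟩, rfl⟩

/-- Monomials are dense: continuous additive maps are determined by their values on monomials. -/
theorem addHom_ext_of_single {Φ Ψ : Ser n A →+ Ser m B} (hΦ : ContAtZero Φ) (hΨ : ContAtZero Ψ)
    (h : ∀ l a, Φ (HahnSeries.single l a) = Ψ (HahnSeries.single l a)) : Φ = Ψ := by
  ext f c
  obtain ⟨W, hW, h1⟩ := hΦ {-c} (Set.isPWO_singleton _)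
  obtain ⟨W', hW', h2⟩ := hΨ {-c} (Set.isPWO_singleton _)
  have hfin := finite_inter_neg f.isPWO_support (hW.union hW')
  -- Truncate `f` to the exponents that can influence the coefficient at `c` of `Φ f` or `Ψ f`.
  -- There are finitely many, and the remainder `f - f'` contributes nothing to either.
  let f' : Ser n A := ∑ l ∈ hfin.toFinset, HahnSeries.single l (f.coeff l)
  have hf' : ∀ l ∈ W ∪ W', (f - f').coeff (-l) = 0 := by
    intro l hl
    rw [HahnSeries.coeff_sub, HahnSeries.coeff_sum]
    simp only [HahnSeries.coeff_single]
    rw [Finset.sum_eq_single (-l), if_pos rfl, sub_self]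
    · exact fun b _ hb => if_neg hb.symm
    · intro h0
      rw [if_pos rfl]
      by_contra h3
      exact h0 (hfin.mem_toFinset.2 ⟨h3, by rwa [neg_neg]⟩)
  have e1 := h1 _ (fun l hl => hf' l (Or.inl hl)) _ rfl
  have e2 := h2 _ (fun l hl => hf' l (Or.inr hl)) _ rfl
  have e3 : Φ f' = Ψ f' := by simp only [f', map_sum, h]
  rw [neg_neg, map_sub, HahnSeries.coeff_sub, sub_eq_zero] at e1 e2
  rw [e1, e2, e3]

/-! ### Continuous maps defined by summable families. -/

section Summation

variable {X : Expo n → Ser m A} {M : Expo n → Expo m} {T : Set (Expo m)}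

theorem finite_summation_support (hM : StrictMono M) (hT : T.IsPWO)
    (hX : ∀ l, (X l).support ⊆ {M l} + T) (f : Ser n A) (c : Expo m) :
    (Function.support fun l => f.coeff l * (X l).coeff c).Finite := by
  refine Set.Finite.of_finite_image (f := fun l => (M l, c - M l)) ?_
    fun a _ b _ hab => hM.injective (Prod.ext_iff.1 hab).1
  refine (Set.AddAntidiagonal.finite_of_isPWO
    (f.isPWO_support.image_of_monotone hM.monotone) hT c).subset ?_
  rintro _ ⟨l, hl, rfl⟩
  have h1 : c ∈ (X l).support := fun h0 => hl (by simp [h0])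
  obtain ⟨_, rfl, t, ht, rfl⟩ := hX l h1
  refine ⟨⟨l, fun h0 => hl (by simp [h0]), rfl⟩, ?_, ?_⟩
  · simpa using ht
  · simp

/-- The continuous linear map `f ↦ ∑ f_l X_l`, for a suitably summable family `X`. -/
noncomputable def summation (hM : StrictMono M) (hT : T.IsPWO)
    (hX : ∀ l, (X l).support ⊆ {M l} + T) : Ser n A →ₗ[A] Ser m A where
  toFun f :=
    { coeff := fun c => ∑ᶠ l, f.coeff l * (X l).coeff c
      isPWO_support' := by
        refine ((f.isPWO_support.image_of_monotone hM.monotone).add hT).mono ?_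
        intro c hc
        obtain ⟨l, hl⟩ : ∃ l, f.coeff l * (X l).coeff c ≠ 0 := by
          by_contra! h
          exact hc (finsum_eq_zero_of_forall_eq_zero h)
        have h1 : c ∈ (X l).support := fun h0 => hl (by simp [h0])
        obtain ⟨_, rfl, t, ht, rfl⟩ := hX l h1
        exact Set.add_mem_add ⟨l, fun h0 => hl (by simp [h0]), rfl⟩ ht }
  map_add' f g := by
    ext c
    simp only [HahnSeries.coeff_add, add_mul]
    exact finsum_add_distrib (finite_summation_support hM hT hX f c)
      (finite_summation_support hM hT hX g c)
  map_smul' a f := by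
    ext c
    simp only [HahnSeries.coeff_smul, smul_eq_mul, mul_assoc, RingHom.id_apply]
    exact (mul_finsum' _ a (finite_summation_support hM hT hX f c)).symm

variable (hM : StrictMono M) (hT : T.IsPWO) (hX : ∀ l, (X l).support ⊆ {M l} + T)

theorem summation_single (l : Expo n) (a : A) :
    summation hM hT hX (HahnSeries.single l a) = a • X l := by
  ext c
  change ∑ᶠ l', (HahnSeries.single l a).coeff l' * (X l').coeff c = _
  rw [finsum_eq_single _ l fun l' hl' => by rw [HahnSeries.coeff_single_of_ne hl', zero_mul],
    HahnSeries.coeff_single_same, HahnSeries.coeff_smul, smul_eq_mul]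

theorem contAtZero_summation : ContAtZero (summation hM hT hX) := by
  intro V hV
  -- If `X l` has a nonzero coefficient at `-c`, then `-c = M l + t`, that is, `N (-l) = c + t` with
  -- `t ∈ T`. So only exponents with `-l` in the preimage of `V + T` under `N` matter.
  let N : Expo n → Expo m := fun l => -M (-l)
  have hN : StrictMono N := fun a b hab => neg_lt_neg (hM (neg_lt_neg hab))
  refine ⟨N ⁻¹' (V + T), isPWO_preimage hN (hV.add hT), fun f hf c hc => ?_⟩
  change ∑ᶠ l, f.coeff l * (X l).coeff (-c) = 0
  refine finsum_eq_zero_of_forall_eq_zero fun l => ?_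
  by_cases h1 : -c ∈ (X l).support
  · obtain ⟨_, rfl, t, ht, h2⟩ := hX l h1
    have h3 := hf (-l) ?_
    · rw [neg_neg] at h3
      rw [h3, zero_mul]
    · refine ⟨c, hc, t, ht, ?_⟩
      change c + t = - M (- -l)
      have h2' : M l + t = -c := h2
      rw [neg_neg, eq_neg_iff_add_eq_zero, add_assoc, add_comm t, h2', add_neg_cancel]
  · rw [not_not.1 h1, mul_zero]

variable (h0 : X 0 = 1) (hadd : ∀ l l', X (l + l') = X l * X l')

include hadd in
-- Both sides are additive and continuous in each factor separately, so density reduces the identity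
-- to monomials, one factor at a time.
theorem summation_mul (f g : Ser n A) :
    summation hM hT hX (f * g) = summation hM hT hX f * summation hM hT hX g := by
  let φ := (summation hM hT hX).toAddMonoidHom
  have hφ : ContAtZero φ := contAtZero_summation hM hT hX
  have hsingle : ∀ l a, φ (HahnSeries.single l a) = a • X l := summation_single hM hT hX
  have key1 : ∀ l a, φ.comp (AddMonoidHom.mulLeft (HahnSeries.single l a)) =
      (AddMonoidHom.mulLeft (φ (HahnSeries.single l a))).comp φ := by
    intro l a
    refine addHom_ext_of_single (hφ.comp (contAtZero_mul_left _))
      ((contAtZero_mul_left _).comp hφ) fun l' b => ?_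
    simp only [AddMonoidHom.comp_apply, AddMonoidHom.coe_mulLeft, HahnSeries.single_mul_single,
      hsingle, hadd, smul_mul_smul_comm]
  have key2 : φ.comp (AddMonoidHom.mulLeft g) = (AddMonoidHom.mulLeft (φ g)).comp φ := by
    refine addHom_ext_of_single (hφ.comp (contAtZero_mul_left _))
      ((contAtZero_mul_left _).comp hφ) fun l a => ?_
    have := DFunLike.congr_fun (key1 l a) g
    simp only [AddMonoidHom.comp_apply, AddMonoidHom.coe_mulLeft] at this ⊢
    rw [mul_comm g, this, mul_comm]
  have := DFunLike.congr_fun key2 f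
  simp only [AddMonoidHom.comp_apply, AddMonoidHom.coe_mulLeft] at this
  rw [mul_comm f, mul_comm (summation hM hT hX f)]
  exact this

/-- The continuous homomorphism of algebras `f ↦ ∑ f_l X_l`, for a multiplicative family `X`. -/
noncomputable def summationHom : Ser n A →A[A] Ser m A where
  toAlgHom := AlgHom.ofLinearMap (summation hM hT hX)
    (by rw [← HahnSeries.single_zero_one, summation_single, one_smul, h0])
    (summation_mul hM hT hX hadd)
  cont := (continuous_iff_contAtZero (summation hM hT hX).toAddMonoidHom).2
    (contAtZero_summation hM hT hX)

theorem summationHom_single (l : Expo n) (a : A) :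
    summationHom hM hT hX h0 hadd (HahnSeries.single l a) = a • X l :=
  summation_single hM hT hX l a

end Summation

end

section

open scoped Pointwise

variable {n : ℕ} {A : Type u} [CommRing A]

/-! ### Splitting off the last variable -/

/-- The exponent whose last coordinate is `c` and whose other coordinates are `a`. -/
def join (c : Expo 1) (a : Expo n) : Expo (n + 1) := vec.symm (Fin.snoc (vec a) (vec c 0))

/-- The last coordinate of an exponent. -/
def topPart (l : Expo (n + 1)) : Expo 1 := vec.symm fun _ => vec l (Fin.last n)

/-- The coordinates of an exponent other than the last one. -/
def initPart (l : Expo (n + 1)) : Expo n := vec.symm fun i => vec l i.castSucc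

@[simp] theorem vec_join_last (c : Expo 1) (a : Expo n) : vec (join c a) (Fin.last n) = vec c 0 := by
  simp [join]

@[simp] theorem vec_join_castSucc (c : Expo 1) (a : Expo n) (i : Fin n) :
    vec (join c a) i.castSucc = vec a i := by
  simp [join]

theorem expo_one_ext {c d : Expo 1} (h : vec c 0 = vec d 0) : c = d :=
  vec.injective (funext fun i => by rwa [Subsingleton.elim i 0])

@[simp] theorem topPart_join (c : Expo 1) (a : Expo n) : topPart (join c a) = c :=
  expo_one_ext (vec_join_last c a)

@[simp] theorem initPart_join (c : Expo 1) (a : Expo n) : initPart (join c a) = a :=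
  vec.injective (funext fun i => vec_join_castSucc c a i)

@[simp] theorem join_topPart_initPart (l : Expo (n + 1)) : join (topPart l) (initPart l) = l := by
  apply vec.injective
  funext i
  refine Fin.lastCases ?_ (fun j => ?_) i
  · simp [topPart]
  · simp [initPart]

theorem join_add (c d : Expo 1) (a b : Expo n) : join (c + d) (a + b) = join c a + join d b := by
  apply vec.injective
  funext i
  refine Fin.lastCases ?_ (fun j => ?_) i
  · simp
  · simp

theorem join_zero : join (0 : Expo 1) (0 : Expo n) = 0 := by
  apply vec.injective
  funext i
  refine Fin.lastCases ?_ (fun j => ?_) i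
  · simp
  · simp

theorem expo_one_lt_iff {c d : Expo 1} : c < d ↔ vec c 0 < vec d 0 := by
  rw [expo_lt_iff]
  constructor
  · rintro ⟨i, -, hi⟩
    rwa [Subsingleton.elim i 0] at hi
  · exact fun h => ⟨0, fun j hj => absurd (Subsingleton.elim j 0) hj.ne', h⟩

theorem join_lt_of_lt {c d : Expo 1} (h : c < d) (a b : Expo n) : join c a < join d b := by
  refine (expo_lt_iff _ _).2 ⟨Fin.last n, fun j hj => absurd hj (not_lt.2 (Fin.le_last j)), ?_⟩
  simpa using expo_one_lt_iff.1 h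

theorem join_strictMono (c : Expo 1) : StrictMono (join c : Expo n → Expo (n + 1)) := by
  intro a b hab
  obtain ⟨i, h1, h2⟩ := (expo_lt_iff _ _).1 hab
  refine (expo_lt_iff _ _).2 ⟨i.castSucc, fun j => ?_, by simpa using h2⟩
  refine Fin.lastCases (fun _ => by simp) (fun k hk => ?_) j
  simpa using h1 k (Fin.castSucc_lt_castSucc_iff.1 hk)

theorem topPart_monotone : Monotone (topPart : Expo (n + 1) → Expo 1) := by
  intro l l' h
  by_contra! hlt
  have := join_lt_of_lt hlt (initPart l') (initPart l)
  rw [join_topPart_initPart, join_topPart_initPart] at this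
  exact absurd h this.not_ge

/-- The coefficient of a power of the last variable in an iterated Laurent series. -/
def lastCoeff (f : Ser (n + 1) A) (c : Expo 1) : Ser n A where
  coeff a := f.coeff (join c a)
  isPWO_support' := isPWO_preimage (join_strictMono c) f.isPWO_support

@[simp] theorem lastCoeff_coeff (f : Ser (n + 1) A) (c : Expo 1) (a : Expo n) :
    (lastCoeff f c).coeff a = f.coeff (join c a) := rfl

/-- An iterated Laurent series in `n + 1` variables as a Laurent series in the last variable. -/
def splitLast (f : Ser (n + 1) A) : Ser 1 (Ser n A) where
  coeff c := lastCoeff f c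
  isPWO_support' := by
    refine (f.isPWO_support.image_of_monotone topPart_monotone).mono fun c hc => ?_
    obtain ⟨a, ha⟩ : ∃ a, f.coeff (join c a) ≠ 0 := by
      by_contra! h
      exact hc (HahnSeries.ext (funext h))
    exact ⟨join c a, ha, topPart_join c a⟩

@[simp] theorem splitLast_coeff (f : Ser (n + 1) A) (c : Expo 1) :
    (splitLast f).coeff c = lastCoeff f c := rfl

theorem splitLast_mul (f g : Ser (n + 1) A) : splitLast (f * g) = splitLast f * splitLast g := by
  ext c a
  rw [splitLast_coeff, lastCoeff_coeff, HahnSeries.coeff_mul, HahnSeries.coeff_mul,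
    HahnSeries.coeff_sum]
  simp only [HahnSeries.coeff_mul, splitLast_coeff]
  rw [Finset.sum_sigma']
  -- A decomposition of an exponent into two summands amounts to a decomposition of its last
  -- coordinate and one of its initial part.
  refine Finset.sum_bij' (fun p _ => ⟨(topPart p.1, topPart p.2), (initPart p.1, initPart p.2)⟩)
    (fun p _ => (join p.1.1 p.2.1, join p.1.2 p.2.2)) ?_ ?_ ?_ ?_ ?_
  · rintro ⟨x, y⟩ h
    rw [Finset.mem_antidiagonal] at h
    obtain ⟨hx, hy, hxy⟩ := h
    have hx' : (lastCoeff f (topPart x)).coeff (initPart x) ≠ 0 := by simpa using hx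
    have hy' : (lastCoeff g (topPart y)).coeff (initPart y) ≠ 0 := by simpa using hy
    have e : join (topPart x + topPart y) (initPart x + initPart y) = join c a := by
      simpa [join_add] using hxy
    rw [Finset.mem_sigma, Finset.mem_antidiagonal, Finset.mem_antidiagonal]
    exact ⟨⟨HahnSeries.ne_zero_of_coeff_ne_zero hx', HahnSeries.ne_zero_of_coeff_ne_zero hy',
      by simpa using congrArg topPart e⟩, hx', hy', by simpa using congrArg initPart e⟩
  · rintro ⟨⟨p, q⟩, ⟨x, y⟩⟩ h
    rw [Finset.mem_sigma, Finset.mem_antidiagonal, Finset.mem_antidiagonal] at h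
    obtain ⟨⟨-, -, h1⟩, hx, hy, h2⟩ := h
    rw [Finset.mem_antidiagonal]
    refine ⟨hx, hy, ?_⟩
    change join p x + join q y = _
    rw [← join_add]
    exact congrArg₂ join h1 h2
  · simp
  · simp
  · simp

/-- Splitting off the last variable, as a ring homomorphism. -/
def splitLastHom : Ser (n + 1) A →+* Ser 1 (Ser n A) where
  toFun := splitLast
  map_one' := by
    ext c a
    rw [splitLast_coeff, lastCoeff_coeff, HahnSeries.coeff_one, HahnSeries.coeff_one]
    by_cases hc : c = 0
    · subst hc
      rw [if_pos rfl, HahnSeries.coeff_one]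
      by_cases ha : a = 0
      · rw [if_pos (ha ▸ join_zero), if_pos ha]
      · rw [if_neg ha, if_neg fun h => ha ((join_strictMono 0).injective (h.trans join_zero.symm))]
    · rw [if_neg hc, if_neg, HahnSeries.coeff_zero]
      intro h
      exact hc (by simpa using congrArg topPart (h.trans join_zero.symm))
  map_mul' := splitLast_mul
  map_zero' := rfl
  map_add' _ _ := rfl

/-- Series in the first `n` variables as series in `n + 1` variables. -/
noncomputable def extendHom : Ser n A →+* Ser (n + 1) A :=
  HahnSeries.embDomainRingHom
    { toFun := join 0, map_zero' := join_zero, map_add' := fun a b => by rw [← join_add, add_zero] }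
    (join_strictMono 0).injective fun _ _ => (join_strictMono 0).le_iff_le

@[simp] theorem extendHom_coeff_join_zero (f : Ser n A) (a : Expo n) :
    (extendHom f).coeff (join 0 a) = f.coeff a :=
  HahnSeries.embDomain_coeff (f := ⟨⟨join 0, (join_strictMono 0).injective⟩,
    (join_strictMono 0).le_iff_le⟩)

theorem extendHom_coeff_of_ne (f : Ser n A) {c : Expo 1} (hc : c ≠ 0) (a : Expo n) :
    (extendHom f).coeff (join c a) = 0 :=
  HahnSeries.embDomain_of_notMem_range (f := ⟨⟨join 0, (join_strictMono 0).injective⟩,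
    (join_strictMono 0).le_iff_le⟩) (by
      rintro ⟨b, hb⟩
      exact hc (by simpa using (congrArg topPart hb).symm))

/-- The series `f t^c`, where `f` is a series in the first `n` variables and `t` is the last one. -/
noncomputable def monomialLast (c : Expo 1) (f : Ser n A) : Ser (n + 1) A :=
  HahnSeries.single (join c 0) 1 * extendHom f

theorem monomialLast_coeff_join (c : Expo 1) (f : Ser n A) (d : Expo 1) (a : Expo n) :
    (monomialLast c f).coeff (join d a) = if d = c then f.coeff a else 0 := by
  have h : join d a = join (d - c) a + join c 0 := by rw [← join_add]; simp
  rw [monomialLast, h, HahnSeries.coeff_single_mul_add, one_mul]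
  split_ifs with hd
  · rw [hd, sub_self, extendHom_coeff_join_zero]
  · exact extendHom_coeff_of_ne f (sub_ne_zero.2 hd) a

/-! ### Units with trivial valuation -/

/-- The prime ideal of all series with coefficients in a prime ideal. -/
noncomputable def coeffPrime (n : ℕ) {A : Type u} [CommRing A] (p : PrimeSpectrum A) :
    PrimeSpectrum (Ser n A) :=
  ⟨RingHom.ker (serMap n (Ideal.Quotient.mk p.asIdeal)), RingHom.ker_isPrime _⟩

theorem mem_coeffPrime {p : PrimeSpectrum A} {f : Ser n A} :
    f ∈ (coeffPrime n p).asIdeal ↔ ∀ l, f.coeff l ∈ p.asIdeal := by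
  change serMap n (Ideal.Quotient.mk p.asIdeal) f = 0 ↔ _
  rw [← HahnSeries.coeff_inj, funext_iff]
  simp [Ideal.Quotient.eq_zero_iff_mem]

theorem nuAt_eq_zero_of_nu_eq_zero {f : (Ser n A)ˣ} (h : nu f = 0) (p : PrimeSpectrum A) :
    nuAt (f : Ser n A) p = 0 :=
  vec.injective (DFunLike.congr_fun h p)

theorem nu_eq_zero_iff (f : (Ser n A)ˣ) : nu f = 0 ↔
    ∀ p : PrimeSpectrum A, (∀ l < 0, (f : Ser n A).coeff l ∈ p.asIdeal) ∧
      (f : Ser n A).coeff 0 ∉ p.asIdeal := by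
  constructor
  · exact fun h p => (nuAt_eq_iff f p 0).1 (nuAt_eq_zero_of_nu_eq_zero h p)
  · intro h
    ext1 p
    exact congrArg vec ((nuAt_eq_iff f p 0).2 (h p))

theorem isNilpotent_iff_mem_prime {a : A} :
    IsNilpotent a ↔ ∀ p : PrimeSpectrum A, a ∈ p.asIdeal := by
  rw [nilpotent_iff_mem_prime]
  exact ⟨fun h p => h p.asIdeal p.2, fun h J hJ => h ⟨J, hJ⟩⟩

theorem isUnit_iff_notMem_prime {a : A} :
    IsUnit a ↔ ∀ p : PrimeSpectrum A, a ∉ p.asIdeal := by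
  constructor
  · exact fun h p hp => p.2.ne_top (Ideal.eq_top_of_isUnit_mem _ hp h)
  · intro h
    by_contra hu
    obtain ⟨I, hI, ha⟩ := exists_max_ideal_of_mem_nonunits hu
    exact h ⟨I, hI.isPrime⟩ ha

theorem coeff_isNilpotent {f : Ser n A} (hf : IsNilpotent f) (l : Expo n) :
    IsNilpotent (f.coeff l) :=
  isNilpotent_iff_mem_prime.2 fun p =>
    mem_coeffPrime.1 (isNilpotent_iff_mem_prime.1 hf (coeffPrime n p)) l

/-- A series with non-negative exponents and invertible constant term is invertible. -/
theorem isUnit_of_nonneg {c : Ser n A} (hc : ∀ l < 0, c.coeff l = 0) (h0 : IsUnit (c.coeff 0)) :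
    IsUnit c := by
  obtain ⟨r, hr⟩ := h0.exists_left_inv
  -- After the constant term is normalized to `1`, subtracting `1` leaves a series with positive
  -- exponents only, and the geometric series applies.
  have h : IsUnit (HahnSeries.C r * c) := by
    rcases subsingleton_or_nontrivial A with hA | hA
    · exact ⟨1, Subsingleton.elim _ _⟩
    apply HahnSeries.isUnit_of_orderTop_pos
    by_contra! hle
    have hne : HahnSeries.C r * c - 1 ≠ 0 := by
      intro h
      rw [h, HahnSeries.orderTop_zero] at hle
      exact absurd hle (by simp)
    rw [HahnSeries.orderTop_of_ne_zero hne] at hle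
    have hmin := HahnSeries.coeff_orderTop_ne (HahnSeries.orderTop_of_ne_zero hne)
    have hle' := WithTop.coe_le_coe.1 hle
    apply hmin
    generalize (HahnSeries.isWF_support (HahnSeries.C r * c - 1)).min _ = l at hle'
    rw [HahnSeries.C_mul_eq_smul, HahnSeries.coeff_sub, HahnSeries.coeff_smul,
      HahnSeries.coeff_one, smul_eq_mul]
    split_ifs with h0'
    · rw [h0', hr, sub_self]
    · rw [hc _ (lt_of_le_of_ne hle' h0'), mul_zero, sub_zero]
  exact isUnit_of_mul_isUnit_right h

/-- The property that every unit with trivial valuation is the sum of a nilpotent series and a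
series with non-negative exponents. -/
def UnitsDecompose (n : ℕ) : Prop :=
  ∀ (A : Type u) [CommRing A] (f : (Ser n A)ˣ), nu f = 0 →
    ∃ x c : Ser n A, IsNilpotent x ∧ (∀ l < 0, c.coeff l = 0) ∧ (f : Ser n A) = x + c

/-- Shift `e` by a monomial `t` so that `e t` has non-negative exponents, and decompose the unit `1
- e + e t`, which is congruent to `1` modulo every prime of coefficients. Moving `e t` to the other
side shows that `1 - e` is nilpotent plus a series with non-negative exponents and invertible
constant term. Hence `1 - e` is a unit, and it is annihilated by `e`. -/
theorem UnitsDecompose.idempotent_eq_zero (h : UnitsDecompose.{u} n) {e : Ser n A}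
    (he : IsIdempotentElem e) (hnil : ∀ l, IsNilpotent (e.coeff l)) : e = 0 := by
  have he2 : e * e = e := he
  let t : Ser n A := HahnSeries.single (-e.order) 1
  let t' : Ser n A := HahnSeries.single e.order 1
  have htt' : t * t' = 1 := by
    simp only [t, t', HahnSeries.single_mul_single, neg_add_cancel, one_mul]; rfl
  -- On the factor cut out by `e` this is the monomial `t`, and on the complementary factor it is
  -- `1`.
  let f : (Ser n A)ˣ := Units.mkOfMulEqOne (1 - e + e * t) (1 - e + e * t') (by
    linear_combination (1 - t - t' + t * t') * he2 + e * htt')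
  have hmem : ∀ p : PrimeSpectrum A, e ∈ (coeffPrime n p).asIdeal := fun p =>
    mem_coeffPrime.2 fun l => isNilpotent_iff_mem_prime.1 (hnil l) p
  have hf : (f : Ser n A) = 1 - e + e * t := rfl
  have hnu : nu f = 0 := by
    rw [nu_eq_zero_iff]
    intro p
    have h1 : (f : Ser n A) - 1 ∈ (coeffPrime n p).asIdeal := by
      rw [hf, show 1 - e + e * t - 1 = e * (t - 1) by ring]
      exact Ideal.mul_mem_right _ _ (hmem p)
    rw [mem_coeffPrime] at h1
    constructor
    · intro l hl
      simpa [HahnSeries.coeff_one, hl.ne] using h1 l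
    · intro h0
      have h2 := h1 0
      rw [HahnSeries.coeff_sub, HahnSeries.coeff_one, if_pos rfl] at h2
      exact p.2.one_notMem (by simpa using p.asIdeal.sub_mem h0 h2)
  obtain ⟨x, c, hx, hc, hxc⟩ := h A f hnu
  -- `1 - e` is the sum of a nilpotent element and of `d`
  let d : Ser n A := c - e * t
  have hd : 1 - e = d + x := by
    simp only [d]; linear_combination hxc - hf
  have hd0 : ∀ l < 0, d.coeff l = 0 := by
    intro l hl
    have h1 : (e * t).coeff l = 0 := by
      rw [show l = (l + e.order) + -e.order by abel, HahnSeries.coeff_mul_single_add, mul_one]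
      exact HahnSeries.coeff_eq_zero_of_lt_order (by simpa using hl)
    rw [HahnSeries.coeff_sub, hc l hl, h1, sub_zero]
  have hdu : IsUnit d := by
    refine isUnit_of_nonneg hd0 (isUnit_iff_notMem_prime.2 fun p hp => ?_)
    have h1 : (e + x).coeff 0 ∈ p.asIdeal := by
      rw [HahnSeries.coeff_add]
      exact add_mem (mem_coeffPrime.1 (hmem p) 0)
        (isNilpotent_iff_mem_prime.1 (coeff_isNilpotent hx 0) p)
    have h2 : (1 : Ser n A).coeff 0 = d.coeff 0 + (e + x).coeff 0 := by
      rw [← HahnSeries.coeff_add]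
      congr 1
      linear_combination hd
    rw [HahnSeries.coeff_one, if_pos rfl] at h2
    exact p.2.one_notMem (h2 ▸ add_mem hp h1)
  have hu : IsUnit (1 - e) := by
    rw [hd]
    exact hx.isUnit_add_left_of_commute hdu (Commute.all _ _)
  refine hu.mul_right_eq_zero.1 ?_
  linear_combination -he2

/-- A well-ordered set of integers is bounded below by its minimum. -/
theorem finite_neg_of_isPWO {s : Set (Expo 1)} (hs : s.IsPWO) : {c | c ∈ s ∧ c < 0}.Finite := by
  rcases Set.eq_empty_or_nonempty s with rfl | hne
  · simp
  refine Set.Finite.of_finite_image (f := fun c => vec c 0)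
    ((Set.finite_Icc (vec (hs.isWF.min hne) 0) 0).subset ?_) fun a _ b _ hab => expo_one_ext hab
  rintro _ ⟨c, ⟨hc, hc0⟩, rfl⟩
  refine ⟨not_lt.1 fun h => ?_, (expo_one_lt_iff.1 hc0).le⟩
  exact hs.isWF.not_lt_min hne hc (expo_one_lt_iff.2 h)

theorem nuAt_splitLast (f : (Ser (n + 1) A)ˣ) (hf : nu f = 0) (p : PrimeSpectrum A) :
    nuAt ((Units.map (splitLastHom (n := n) (A := A) : Ser (n + 1) A →* Ser 1 (Ser n A)) f :
      (Ser 1 (Ser n A))ˣ) : Ser 1 (Ser n A)) (coeffPrime n p) = 0 := by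
  rw [nuAt_eq_iff]
  have h := (nu_eq_zero_iff f).1 hf p
  constructor
  · intro c hc
    refine mem_coeffPrime.2 fun a => h.1 _ ?_
    rw [← join_zero]
    exact join_lt_of_lt hc _ _
  · intro h0
    refine h.2 ?_
    rw [← join_zero]
    exact mem_coeffPrime.1 h0 0

/-- The hypothesis on `f` controls only the primes `coeffPrime n p` of `Ser n A`, by
`nuAt_splitLast`. The locus of nonzero valuation is clopen and misses these primes, so its
idempotent has nilpotent coefficients and must vanish. -/
theorem UnitsDecompose.nu_splitLast (h : UnitsDecompose.{u} n) (f : (Ser (n + 1) A)ˣ)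
    (hf : nu f = 0) :
    nu (Units.map (splitLastHom (n := n) (A := A) : Ser (n + 1) A →* Ser 1 (Ser n A)) f) = 0 := by
  set g := Units.map (splitLastHom (n := n) (A := A) : Ser (n + 1) A →* Ser 1 (Ser n A)) f
  have hclopen : IsClopen {q : PrimeSpectrum (Ser n A) | nu g q ≠ 0} :=
    ((nu g).isLocallyConstant.isClopen_fiber 0).compl
  let e := PrimeSpectrum.isIdempotentElemEquivClopens.symm
    (⟨_, hclopen⟩ : TopologicalSpace.Clopens (PrimeSpectrum (Ser n A)))
  have he : ∀ q : PrimeSpectrum (Ser n A), e.1 ∉ q.asIdeal ↔ nu g q ≠ 0 := fun q =>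
    SetLike.ext_iff.1 (PrimeSpectrum.basicOpen_isIdempotentElemEquivClopens_symm
      (⟨_, hclopen⟩ : TopologicalSpace.Clopens (PrimeSpectrum (Ser n A)))) q
  have he0 : e.1 = 0 := by
    refine h.idempotent_eq_zero e.2 fun l => isNilpotent_iff_mem_prime.2 fun p => ?_
    refine mem_coeffPrime.1 ?_ l
    by_contra hnot
    exact (he _).1 hnot (congrArg vec (nuAt_splitLast f hf p))
  ext1 q
  by_contra hq
  exact (he q).2 hq (he0 ▸ q.asIdeal.zero_mem)

/-- As a Laurent series in the last variable, `f` has finitely many terms of negative degree, all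
with nilpotent coefficients. Its term of degree zero is a unit to which the induction hypothesis
applies, and terms of positive degree have only positive exponents. -/
theorem UnitsDecompose.succ (h : UnitsDecompose.{u} n) : UnitsDecompose.{u} (n + 1) := by
  intro A _ f hf
  have hg := (nu_eq_zero_iff _).1 (h.nu_splitLast f hf)
  have hneg : ∀ c < 0, IsNilpotent (lastCoeff (f : Ser (n + 1) A) c) := fun c hc =>
    isNilpotent_iff_mem_prime.2 fun q => (hg q).1 c hc
  have hu : IsUnit (lastCoeff (f : Ser (n + 1) A) 0) :=
    isUnit_iff_notMem_prime.2 fun q => (hg q).2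
  obtain ⟨x, c, hx, hc, hxc⟩ := h A hu.unit ((nu_eq_zero_iff _).2 fun p => by
    have h1 := (nu_eq_zero_iff f).1 hf p
    rw [IsUnit.unit_spec]
    constructor
    · intro l hl
      exact h1.1 _ ((join_strictMono 0 hl).trans_eq join_zero)
    · rw [lastCoeff_coeff, join_zero]
      exact h1.2)
  rw [IsUnit.unit_spec] at hxc
  have hfin := finite_neg_of_isPWO (splitLast (f : Ser (n + 1) A)).isPWO_support
  let y : Ser (n + 1) A := ∑ d ∈ hfin.toFinset, monomialLast d (lastCoeff (f : Ser (n + 1) A) d)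
  have hy : IsNilpotent y := by
    refine isNilpotent_sum fun d hd => ?_
    exact (Commute.all _ _).isNilpotent_mul_left ((hneg d (hfin.mem_toFinset.1 hd).2).map extendHom)
  have hycoeff : ∀ d a, y.coeff (join d a) = if d < 0 then (f : Ser (n + 1) A).coeff (join d a)
      else 0 := by
    intro d a
    simp only [y, HahnSeries.coeff_sum, monomialLast_coeff_join]
    split_ifs with hd
    · rw [Finset.sum_eq_single d, if_pos rfl, lastCoeff_coeff]
      · exact fun b _ hb => if_neg hb.symm
      · intro hnot
        rw [if_pos rfl]
        by_contra h0
        exact hnot (hfin.mem_toFinset.2 ⟨HahnSeries.ne_zero_of_coeff_ne_zero h0, hd⟩)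
    · refine Finset.sum_eq_zero fun b hb => if_neg ?_
      rintro rfl
      exact hd (hfin.mem_toFinset.1 hb).2
  refine ⟨y + extendHom x, f - (y + extendHom x),
    (Commute.all _ _).isNilpotent_add hy (hx.map extendHom), fun l hl => ?_, by ring⟩
  obtain ⟨d, a, rfl⟩ : ∃ d a, join d a = l := ⟨_, _, join_topPart_initPart l⟩
  rw [HahnSeries.coeff_sub, HahnSeries.coeff_add, hycoeff]
  rcases lt_trichotomy d 0 with hd | rfl | hd
  · rw [if_pos hd, extendHom_coeff_of_ne x hd.ne, add_zero, sub_self]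
  · rw [if_neg (lt_irrefl _), extendHom_coeff_join_zero, zero_add, ← lastCoeff_coeff, hxc,
      HahnSeries.coeff_add, add_sub_cancel_left]
    exact hc a ((join_strictMono 0).lt_iff_lt.1 (hl.trans_eq join_zero.symm))
  · rw [← join_zero] at hl
    exact absurd hl (join_lt_of_lt hd _ _).not_gt

theorem unitsDecompose (n : ℕ) : UnitsDecompose.{u} n := by
  induction n with
  | zero =>
    intro A _ f _
    refine ⟨0, f, IsNilpotent.zero, fun l hl => ?_, (zero_add _).symm⟩
    obtain ⟨i, -⟩ := (expo_lt_iff _ _).1 hl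
    exact i.elim0
  | succ n ih => exact ih.succ

end

section

open scoped Pointwise

variable {n m : ℕ} {A B : Type u} [CommRing A] [CommRing B]

/-! ### Supports of powers of units with trivial valuation -/

/-- In the binomial expansion of `(x + c)^k` only the terms with `x^j`, `j < N`, survive. The powers
of `c` are all supported in the submonoid generated by the support of `c`, which is well-ordered
because its generators are non-negative. -/
theorem exists_isPWO_support_pow (f : (Ser m A)ˣ) (hf : nu f = 0) :
    ∃ T : Set (Expo m), T.IsPWO ∧ ∀ k : ℕ, ((f : Ser m A) ^ k).support ⊆ T := by
  obtain ⟨x, c, ⟨N, hN⟩, hc, hxc⟩ := unitsDecompose m A f hf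
  let S : Set (Expo m) := AddSubmonoid.closure c.support
  have hS : S.IsPWO := c.isPWO_support.addSubmonoid_closure fun l hl => by
    by_contra! hlt
    exact hl (hc l hlt)
  refine ⟨(⋃ j ∈ Finset.range N, (x ^ j).support) + S, Set.IsPWO.add ?_ hS, fun k => ?_⟩
  · exact (Finset.isPWO_bUnion _).2 fun j _ => (x ^ j).isPWO_support
  · intro l hl
    by_contra hnot
    refine hl ?_
    rw [hxc, add_pow, HahnSeries.coeff_sum]
    refine Finset.sum_eq_zero fun j _ => ?_
    have h0 : (x ^ j * c ^ (k - j)).coeff l = 0 := by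
      by_cases hj : j < N
      · by_contra h1
        refine hnot ?_
        obtain ⟨a, ha, b, hb, rfl⟩ := HahnSeries.support_mul_subset h1
        exact Set.add_mem_add (Set.mem_biUnion (Finset.mem_range.2 hj) ha)
          (HahnSeries.SummableFamily.support_pow_subset_closure c _ hb)
      · rw [pow_eq_zero_of_le (not_lt.1 hj) hN, zero_mul, HahnSeries.coeff_zero]
    rw [← nsmul_eq_mul', HahnSeries.coeff_nsmul, Pi.smul_apply, h0, smul_zero]

theorem nu_inv_eq_zero {f : (Ser m A)ˣ} (hf : nu f = 0) : nu f⁻¹ = 0 := by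
  have h := nu_mul f f⁻¹
  have h1 := nu_mul (1 : (Ser m A)ˣ) 1
  rw [mul_one, left_eq_add] at h1
  rwa [mul_inv_cancel, h1, hf, zero_add, eq_comm] at h

theorem exists_isPWO_support_zpow (f : (Ser m A)ˣ) (hf : nu f = 0) :
    ∃ T : Set (Expo m), T.IsPWO ∧
      ∀ k : ℤ, ((f ^ k : (Ser m A)ˣ) : Ser m A).support ⊆ T := by
  obtain ⟨T, hT, h⟩ := exists_isPWO_support_pow f hf
  obtain ⟨T', hT', h'⟩ := exists_isPWO_support_pow f⁻¹ (nu_inv_eq_zero hf)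
  refine ⟨T ∪ T', hT.union hT', fun k => ?_⟩
  obtain ⟨j, rfl | rfl⟩ := k.eq_nat_or_neg
  · rw [zpow_natCast, Units.val_pow_eq_pow_val]
    exact (h j).trans Set.subset_union_left
  · rw [_root_.zpow_neg, zpow_natCast, ← inv_pow, Units.val_pow_eq_pow_val]
    exact (h' j).trans Set.subset_union_right

theorem exists_isPWO_support_prod_zpow {ι : Type*} (s : Finset ι) (f : ι → (Ser m A)ˣ)
    (hf : ∀ i, nu (f i) = 0) :
    ∃ T : Set (Expo m), T.IsPWO ∧
      ∀ k : ι → ℤ, ((∏ i ∈ s, f i ^ k i : (Ser m A)ˣ) : Ser m A).support ⊆ T := by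
  classical
  induction s using Finset.induction_on with
  | empty =>
    exact ⟨_, (1 : Ser m A).isPWO_support, fun k => by simp⟩
  | insert a s ha ih =>
    obtain ⟨T, hT, h⟩ := ih
    obtain ⟨T', hT', h'⟩ := exists_isPWO_support_zpow (f a) (hf a)
    refine ⟨T' + T, hT'.add hT, fun k => ?_⟩
    rw [Finset.prod_insert ha, Units.val_mul]
    exact HahnSeries.support_mul_subset.trans (Set.add_subset_add (h' _) (h _))

/-! ### Monomials -/

/-- The monomial `t^l` as an invertible series. -/
noncomputable def monomialUnit (A : Type u) [CommRing A] (l : Expo n) : (Ser n A)ˣ where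
  val := HahnSeries.single l 1
  inv := HahnSeries.single (-l) 1
  val_inv := by rw [HahnSeries.single_mul_single, add_neg_cancel, one_mul]; rfl
  inv_val := by rw [HahnSeries.single_mul_single, neg_add_cancel, one_mul]; rfl

theorem monomialUnit_val (l : Expo n) : (monomialUnit A l : Ser n A) = HahnSeries.single l 1 := rfl

theorem monomialUnit_add (l l' : Expo n) :
    monomialUnit A (l + l') = monomialUnit A l * monomialUnit A l' := by
  ext1
  rw [Units.val_mul, monomialUnit_val, monomialUnit_val, monomialUnit_val,
    HahnSeries.single_mul_single, one_mul]

/-- Monomials, as a homomorphism. -/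
noncomputable def monomialHom (n : ℕ) (A : Type u) [CommRing A] :
    Multiplicative (Expo n) →* (Ser n A)ˣ where
  toFun l := monomialUnit A l.toAdd
  map_one' := rfl
  map_mul' l l' := monomialUnit_add l.toAdd l'.toAdd

theorem monomialUnit_zsmul (k : ℤ) (l : Expo n) :
    monomialUnit A (k • l) = monomialUnit A l ^ k :=
  map_zpow (monomialHom n A) (Multiplicative.ofAdd l) k

theorem monomialUnit_sum {ι : Type*} (s : Finset ι) (l : ι → Expo n) :
    monomialUnit A (∑ i ∈ s, l i) = ∏ i ∈ s, monomialUnit A (l i) := by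
  have h := map_prod (monomialHom n A) (fun i => Multiplicative.ofAdd (l i)) s
  rwa [← ofAdd_sum] at h

theorem expo_eq_sum (l : Expo n) : l = ∑ i, vec l i • (vec.symm (Pi.single i 1) : Expo n) := by
  change (l : Fin n → ℤ) = ∑ i, (l : Fin n → ℤ) i • (Pi.single i 1 : Fin n → ℤ)
  exact pi_eq_sum_univ' l

theorem monomialUnit_eq_prod (l : Expo n) : monomialUnit A l = ∏ i, tvar A i ^ vec l i := by
  conv_lhs => rw [expo_eq_sum l]
  rw [monomialUnit_sum]
  exact Finset.prod_congr rfl fun i _ => monomialUnit_zsmul _ _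

/-- The valuation at a prime ideal, as a homomorphism. -/
noncomputable def nuAtHom (p : PrimeSpectrum A) : (Ser m A)ˣ →* Multiplicative (Expo m) where
  toFun f := Multiplicative.ofAdd (nuAt (f : Ser m A) p)
  map_one' := by
    rw [Units.val_one, nuAt, map_one, HahnSeries.order_one]; rfl
  map_mul' f g := congrArg Multiplicative.ofAdd (nuAt_mul f g p)

theorem nuAt_pow (f : (Ser m A)ˣ) (p : PrimeSpectrum A) (k : ℕ) :
    nuAt ((f ^ k : (Ser m A)ˣ) : Ser m A) p = k • nuAt (f : Ser m A) p :=
  congrArg Multiplicative.toAdd (map_pow (nuAtHom p) f k)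

theorem nuAt_prod_zpow (f : Fin n → (Ser m A)ˣ) (p : PrimeSpectrum A) (k : Fin n → ℤ) :
    nuAt ((∏ i, f i ^ k i : (Ser m A)ˣ) : Ser m A) p = ∑ i, k i • nuAt (f i : Ser m A) p := by
  have h : nuAtHom p (∏ i, f i ^ k i) =
      Multiplicative.ofAdd (∑ i, k i • nuAt (f i : Ser m A) p) := by
    rw [map_prod, ofAdd_sum]
    exact Finset.prod_congr rfl fun i _ => map_zpow (nuAtHom p) _ _
  exact congrArg Multiplicative.toAdd h

/-- Homomorphisms over a ring homomorphism of coefficients are determined by the images of the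
variables. -/
theorem map_single_eq {m' : ℕ} {g : A →+* B} {Φ : Ser n A →+* Ser m' B}
    (hΦ : ∀ a f, Φ (a • f) = g a • Φ f) (l : Expo n) (a : A) :
    Φ (HahnSeries.single l a) = g a •
      ((∏ i, Units.map (Φ : Ser n A →* Ser m' B) (tvar A i) ^ vec l i : (Ser m' B)ˣ) :
        Ser m' B) := by
  have h1 : HahnSeries.single l a = a • (monomialUnit A l : Ser n A) := by
    rw [monomialUnit_val, ← HahnSeries.C_mul_eq_smul, HahnSeries.C_apply,
      HahnSeries.single_mul_single, zero_add, mul_one]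
  rw [h1, hΦ, monomialUnit_eq_prod]
  congr 1
  have h2 := map_prod (Units.map (Φ : Ser n A →* Ser m' B)) (fun i => tvar A i ^ vec l i)
    Finset.univ
  simp only [map_zpow] at h2
  rw [← h2]
  rfl

/-- Semilinearity over `g` makes this usable for the two composites in the base change square as
well as for algebra homomorphisms. -/
theorem ringHom_ext_of_tvar {g : A →+* B} {Φ Ψ : Ser n A →+* Ser m B}
    (hΦ : ∀ a f, Φ (a • f) = g a • Φ f) (hΨ : ∀ a f, Ψ (a • f) = g a • Ψ f)
    (hΦc : ContAtZero Φ) (hΨc : ContAtZero Ψ)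
    (h : ∀ i : Fin n, Φ (tvar A i) = Ψ (tvar A i)) : Φ = Ψ := by
  have hu : ∀ i, Units.map (Φ : Ser n A →* Ser m B) (tvar A i) =
      Units.map (Ψ : Ser n A →* Ser m B) (tvar A i) := fun i => Units.ext (h i)
  have := addHom_ext_of_single (Φ := Φ.toAddMonoidHom) (Ψ := Ψ.toAddMonoidHom) hΦc hΨc
    fun l a => by
      change Φ _ = Ψ _
      rw [map_single_eq hΦ, map_single_eq hΨ]
      simp only [hu]
  exact RingHom.ext fun f => DFunLike.congr_fun this f

theorem contAtZero_algHom (φ : Ser n A →A[A] Ser m A) : ContAtZero φ :=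
  (continuous_iff_contAtZero (φ : Ser n A →+* Ser m A).toAddMonoidHom).1 φ.cont

theorem algHom_ext_of_tvar {φ ψ : Ser n A →A[A] Ser m A}
    (h : ∀ i : Fin n, φ (tvar A i) = ψ (tvar A i)) : φ = ψ := by
  have := ringHom_ext_of_tvar (g := RingHom.id A) (Φ := (φ : Ser n A →+* Ser m A))
    (Ψ := (ψ : Ser n A →+* Ser m A)) (fun a f => map_smul φ a f) (fun a f => map_smul ψ a f)
    (contAtZero_algHom φ) (contAtZero_algHom ψ) h
  exact ContinuousAlgHom.ext fun f => DFunLike.congr_fun this f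

/-! ### The matrix of a continuous homomorphism -/

/-- If the valuation `γ` were `≤ 0`, the exponents `-(k • γ)` would form a well-ordered set `V`,
while `-(k • l)` strictly decreases and so leaves every well-ordered `W`. Thus some power of `t^l`
lies in the neighbourhood given by `W`, although its image has a coefficient outside `p` at `k • γ`.
-/
theorem nuAt_map_monomial_pos (φ : Ser n A →A[A] Ser m A) (p : PrimeSpectrum A) {l : Expo n}
    (hl : 0 < l) :
    0 < nuAt ((Units.map (φ : Ser n A →* Ser m A) (monomialUnit A l) : (Ser m A)ˣ) : Ser m A)
      p := by
  set G := Units.map (φ : Ser n A →* Ser m A) (monomialUnit A l)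
  set γ := nuAt (G : Ser m A) p
  by_contra! hγ
  have hV : (Set.range fun k : ℕ => -(k • γ)).IsPWO := by
    rw [← Set.image_univ]
    refine Set.IsPWO.image_of_monotone (Set.IsPWO.of_linearOrder _) fun a b hab => ?_
    exact neg_le_neg (nsmul_le_nsmul_left_of_nonpos hγ hab)
  obtain ⟨W, hW, h⟩ := contAtZero_algHom φ _ hV
  obtain ⟨k, hk⟩ : ∃ k : ℕ, -(k • l) ∉ W := by
    by_contra! hall
    refine Set.isWF_iff_no_descending_seq.1 hW.isWF (fun k : ℕ => -(k • l)) (fun a b hab => ?_) hall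
    exact neg_lt_neg (nsmul_left_strictMono hl hab)
  have h1 := h (HahnSeries.single (k • l) 1) (fun w hw => by
    rw [HahnSeries.coeff_single_of_ne]
    rintro h0
    rw [← h0, neg_neg] at hk
    exact hk hw) _ ⟨k, rfl⟩
  have h2 : φ (HahnSeries.single (k • l) 1) = ((G ^ k : (Ser m A)ˣ) : Ser m A) := by
    rw [Units.val_pow_eq_pow_val]
    change _ = (φ (HahnSeries.single l 1)) ^ k
    rw [← map_pow, HahnSeries.single_pow, one_pow]
  rw [neg_neg, h2] at h1
  exact ((nuAt_eq_iff (G ^ k) p _).1 (nuAt_pow G p k)).2 (by rw [h1]; exact p.asIdeal.zero_mem)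

/-- The valuation at `p` is multiplicative, so the matrix at `p` applied to `l` is the valuation of
the image of `t^l`. -/
theorem upsilon_mem_MPlus (φ : Ser n A →A[A] Ser m A) (p : PrimeSpectrum A) :
    ((upsilon φ).map fun a => a p) ∈ MPlus m n := by
  intro l hl
  have h := nuAt_map_monomial_pos φ p hl
  rw [monomialUnit_eq_prod, map_prod] at h
  simp only [map_zpow] at h
  rw [nuAt_prod_zpow] at h
  convert h using 1
  apply vec.injective
  rw [Equiv.apply_symm_apply]
  funext j
  have e : vec (∑ i, vec l i • nuAt ((Units.map (φ : Ser n A →* Ser m A) (tvar A i) :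
      (Ser m A)ˣ) : Ser m A) p) j = ∑ i, vec l i * vec (nuAt ((Units.map
        (φ : Ser n A →* Ser m A) (tvar A i) : (Ser m A)ˣ) : Ser m A) p) j :=
    Finset.sum_apply j Finset.univ (fun i => (vec l i • nuAt ((Units.map
      (φ : Ser n A →* Ser m A) (tvar A i) : (Ser m A)ˣ) : Ser m A) p : Fin m → ℤ))
  rw [e, Matrix.mulVec, dotProduct]
  exact Finset.sum_congr rfl fun i _ => mul_comm _ _

/-! ### Homomorphisms with constant matrix -/

/-- The action of a matrix on exponents. -/
def matMap (M : Matrix (Fin m) (Fin n) ℤ) (l : Expo n) : Expo m := vec.symm (M *ᵥ vec l)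

theorem matMap_add (M : Matrix (Fin m) (Fin n) ℤ) (l l' : Expo n) :
    matMap M (l + l') = matMap M l + matMap M l' :=
  congrArg vec.symm (Matrix.mulVec_add M (vec l) (vec l'))

theorem matMap_strictMono {M : Matrix (Fin m) (Fin n) ℤ} (hM : M ∈ MPlus m n) :
    StrictMono (matMap M) := by
  intro a b hab
  have h : (0 : Expo m) < matMap M (b - a) := hM _ (sub_pos.2 hab)
  rw [← sub_add_cancel b a, matMap_add]
  exact lt_add_of_pos_left _ h

theorem exists_algHom_of_matrix {M : Matrix (Fin m) (Fin n) ℤ} (hM : M ∈ MPlus m n)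
    (f : Fin n → (Ser m A)ˣ) (hf : ∀ i, nu (f i) = 0) :
    ∃ φ : Ser n A →A[A] Ser m A, ∀ i,
      φ (tvar A i) = (monomialUnit A (vec.symm fun j => M j i) : Ser m A) * f i := by
  obtain ⟨T, hT, hfT⟩ := exists_isPWO_support_prod_zpow Finset.univ f hf
  -- The forced image of `t^l`. Its support lies in `matMap M l + T` with `T` independent of `l`, as
  -- summability requires.
  let X : Expo n → Ser m A := fun l =>
    ((monomialUnit A (matMap M l) * ∏ i, f i ^ vec l i : (Ser m A)ˣ) : Ser m A)
  have hX : ∀ l, (X l).support ⊆ {matMap M l} + T := fun l =>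
    HahnSeries.support_mul_subset.trans
      (Set.add_subset_add HahnSeries.support_single_subset (hfT _))
  have h0 : X 0 = 1 := by
    have : matMap M 0 = 0 := congrArg vec.symm (Matrix.mulVec_zero M)
    simp only [X, this, vec_zero, Pi.zero_apply, zpow_zero, Finset.prod_const_one, mul_one]
    rfl
  have hadd : ∀ l l', X (l + l') = X l * X l' := by
    intro l l'
    simp only [X, matMap_add, monomialUnit_add, vec_add, Pi.add_apply, _root_.zpow_add,
      Finset.prod_mul_distrib, ← Units.val_mul]
    rw [mul_mul_mul_comm]
  refine ⟨summationHom (matMap_strictMono hM) hT hX h0 hadd, fun i => ?_⟩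
  have h1 := summationHom_single (matMap_strictMono hM) hT hX h0 hadd
    (vec.symm (Pi.single i 1)) 1
  rw [one_smul] at h1
  refine h1.trans ?_
  simp only [X, Units.val_mul]
  congr 2
  · congr 1
    exact congrArg vec.symm (by simp; rfl)
  · rw [Finset.prod_eq_single i]
    · simp
    · intro b _ hb
      simp [hb]
    · simp

end

section

variable {n m : ℕ} {A B : Type u} [CommRing A] [CommRing B]

/-! ### Idempotents and locally constant functions -/

theorem idempotent_ext {e e' : A} (he : IsIdempotentElem e) (he' : IsIdempotentElem e')
    (h : ∀ p : PrimeSpectrum A, e ∉ p.asIdeal ↔ e' ∉ p.asIdeal) : e = e' := by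
  have : PrimeSpectrum.isIdempotentElemEquivClopens ⟨e, he⟩ =
      PrimeSpectrum.isIdempotentElemEquivClopens ⟨e', he'⟩ := by
    ext p
    exact h p
  exact congrArg Subtype.val (PrimeSpectrum.isIdempotentElemEquivClopens.injective this)

section FiberIdem

variable {X : Type} (v : LocallyConstant (PrimeSpectrum A) X)

/-- The idempotent that corresponds to a fiber of a locally constant function. -/
noncomputable def fiberIdem (x : X) : A :=
  (PrimeSpectrum.isIdempotentElemEquivClopens.symm
    (⟨v ⁻¹' {x}, v.isLocallyConstant.isClopen_fiber _⟩ :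
      TopologicalSpace.Clopens (PrimeSpectrum A))).1

theorem fiberIdem_isIdempotentElem (x : X) : IsIdempotentElem (fiberIdem v x) :=
  (PrimeSpectrum.isIdempotentElemEquivClopens.symm
    (⟨v ⁻¹' {x}, v.isLocallyConstant.isClopen_fiber _⟩ :
      TopologicalSpace.Clopens (PrimeSpectrum A))).2

theorem fiberIdem_notMem_iff (x : X) (p : PrimeSpectrum A) :
    fiberIdem v x ∉ p.asIdeal ↔ v p = x :=
  SetLike.ext_iff.1 (PrimeSpectrum.basicOpen_isIdempotentElemEquivClopens_symm
    (⟨v ⁻¹' {x}, v.isLocallyConstant.isClopen_fiber _⟩ :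
      TopologicalSpace.Clopens (PrimeSpectrum A))) p

theorem eq_fiberIdem {e : A} {x : X} (he : IsIdempotentElem e)
    (h : ∀ p : PrimeSpectrum A, e ∉ p.asIdeal ↔ v p = x) : e = fiberIdem v x :=
  idempotent_ext he (fiberIdem_isIdempotentElem v x) fun p =>
    (h p).trans (fiberIdem_notMem_iff v x p).symm

theorem eq_zero_of_idempotent {e : A} (he : IsIdempotentElem e)
    (h : ∀ p : PrimeSpectrum A, e ∈ p.asIdeal) : e = 0 :=
  idempotent_ext he IsIdempotentElem.zero fun p => by simp [h p]

theorem fiberIdem_mul_of_ne {x y : X} (hxy : x ≠ y) : fiberIdem v x * fiberIdem v y = 0 := by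
  refine eq_zero_of_idempotent
    ((fiberIdem_isIdempotentElem v x).mul (fiberIdem_isIdempotentElem v y)) fun p => ?_
  by_contra hnot
  have h1 := (fiberIdem_notMem_iff v x p).1 fun h => hnot (Ideal.mul_mem_right _ _ h)
  have h2 := (fiberIdem_notMem_iff v y p).1 fun h => hnot (Ideal.mul_mem_left _ _ h)
  exact hxy (h1.symm.trans h2)

theorem fiberIdem_eq_zero {x : X} (hx : ∀ p, v p ≠ x) : fiberIdem v x = 0 :=
  eq_zero_of_idempotent (fiberIdem_isIdempotentElem v x) fun p => by
    by_contra h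
    exact hx p ((fiberIdem_notMem_iff v x p).1 h)

theorem orthogonalIdempotents_fiberIdem : OrthogonalIdempotents (fiberIdem v) :=
  ⟨fiberIdem_isIdempotentElem v, fun _ _ h => fiberIdem_mul_of_ne v h⟩

theorem sum_fiberIdem {s : Finset X} (hs : ∀ p, v p ∈ s) : ∑ x ∈ s, fiberIdem v x = 1 := by
  refine idempotent_ext (orthogonalIdempotents_fiberIdem v).isIdempotentElem_sum
    IsIdempotentElem.one fun p => iff_of_true (fun h => ?_) p.2.one_notMem
  refine (fiberIdem_notMem_iff v (v p) p).2 rfl ?_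
  have h1 := p.asIdeal.mul_mem_left (fiberIdem v (v p)) h
  rwa [Finset.mul_sum, Finset.sum_eq_single_of_mem _ (hs p)
    fun b _ hb => fiberIdem_mul_of_ne v hb.symm, (fiberIdem_isIdempotentElem v _).eq] at h1

theorem map_fiberIdem (g : A →+* B) (x : X) : g (fiberIdem v x) = fiberIdem (pullback g v) x :=
  eq_fiberIdem _ ((fiberIdem_isIdempotentElem v x).map g) fun p =>
    fiberIdem_notMem_iff v x (PrimeSpectrum.comap g p)

/-- A locally constant function on the quasi-compact space `Spec A` has finitely many values, so its
fiber idempotents sum to `1` and equality may be checked on each part. -/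
theorem eq_of_fiberIdem_smul_eq {M : Type*} [AddCommGroup M] [Module A M] {y z : M}
    (h : ∀ x, fiberIdem v x • y = fiberIdem v x • z) : y = z := by
  have hs : ∀ p, v p ∈ v.range_finite.toFinset := fun p => by simp
  rw [← one_smul A y, ← one_smul A z, ← sum_fiberIdem v hs, Finset.sum_smul, Finset.sum_smul]
  exact Finset.sum_congr rfl fun x _ => h x

theorem fiberIdem_comp {Y : Type} (w : LocallyConstant (PrimeSpectrum A) Y) (g : X → Y)
    (hw : ∀ p, w p = g (v p)) (x : X) :
    fiberIdem v x * fiberIdem w (g x) = fiberIdem v x := by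
  refine idempotent_ext ((fiberIdem_isIdempotentElem v x).mul (fiberIdem_isIdempotentElem w _))
    (fiberIdem_isIdempotentElem v x) fun p => ?_
  constructor
  · exact fun h h' => h (Ideal.mul_mem_right _ _ h')
  · intro h
    refine p.2.mul_notMem h ((fiberIdem_notMem_iff w _ p).2 ?_)
    rw [hw, (fiberIdem_notMem_iff v x p).1 h]

end FiberIdem

/-! ### The monomials `t^v` -/

theorem tpow_coeff (v : LocallyConstant (PrimeSpectrum A) (Fin n → ℤ)) (l : Expo n) :
    (tpow v).coeff l = fiberIdem v (vec l) := rfl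

/-- The condition on `a` says that it is supported where `v = x`; there `t^v` is an ordinary
monomial. A general `a` allows parts finer than the fibers of `v`, such as fibers of the whole
matrix. -/
theorem smul_tpow (v : LocallyConstant (PrimeSpectrum A) (Fin n → ℤ)) {x : Fin n → ℤ} {a : A}
    (ha : a * fiberIdem v x = a) :
    a • tpow v = a • (monomialUnit A (vec.symm x) : Ser n A) := by
  ext l
  rw [HahnSeries.coeff_smul, HahnSeries.coeff_smul, tpow_coeff, monomialUnit_val, smul_eq_mul,
    smul_eq_mul]
  by_cases hl : vec l = x
  · subst hl
    rw [Equiv.symm_apply_apply, HahnSeries.coeff_single_same, mul_one, ha]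
  · rw [HahnSeries.coeff_single_of_ne fun h => hl (vec.eq_symm_apply.1 h), mul_zero, ← ha, mul_assoc,
      fiberIdem_mul_of_ne _ (Ne.symm hl), mul_zero]

theorem fiberIdem_smul_tpow (v : LocallyConstant (PrimeSpectrum A) (Fin n → ℤ)) (x : Fin n → ℤ) :
    fiberIdem v x • tpow v = fiberIdem v x • (monomialUnit A (vec.symm x) : Ser n A) :=
  smul_tpow v (fiberIdem_isIdempotentElem v x)

theorem tpow_mul_tpow_neg (v : LocallyConstant (PrimeSpectrum A) (Fin n → ℤ)) :
    tpow v * tpow (-v) = 1 := by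
  refine eq_of_fiberIdem_smul_eq v fun x => ?_
  have h1 := smul_tpow (-v) (x := -x) (fiberIdem_comp v (-v) (fun y => -y) (fun _ => rfl) x)
  rw [← smul_mul_assoc, fiberIdem_smul_tpow, smul_mul_assoc, ← mul_smul_comm, h1, mul_smul_comm,
    ← Units.val_mul, ← monomialUnit_add]
  congr 1
  have : (vec.symm x + vec.symm (-x) : Expo n) = 0 := add_neg_cancel (vec.symm x)
  rw [this]
  rfl

/-- The monomial `t^v` as an invertible series. -/
noncomputable def tpowUnit (v : LocallyConstant (PrimeSpectrum A) (Fin n → ℤ)) : (Ser n A)ˣ :=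
  Units.mkOfMulEqOne (tpow v) (tpow (-v)) (tpow_mul_tpow_neg v)

theorem tpowUnit_val (v : LocallyConstant (PrimeSpectrum A) (Fin n → ℤ)) :
    (tpowUnit v : Ser n A) = tpow v := rfl

theorem tpowUnit_neg (v : LocallyConstant (PrimeSpectrum A) (Fin n → ℤ)) :
    tpowUnit (-v) = (tpowUnit v)⁻¹ :=
  Units.ext rfl

theorem nu_tpowUnit (v : LocallyConstant (PrimeSpectrum A) (Fin n → ℤ)) : nu (tpowUnit v) = v := by
  ext1 p
  have h : nuAt (tpowUnit v : Ser n A) p = vec.symm (v p) := by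
    rw [nuAt_eq_iff]
    refine ⟨fun l hl => ?_, (fiberIdem_notMem_iff v _ p).2 rfl⟩
    by_contra hnot
    have h1 : v p = vec l := (fiberIdem_notMem_iff v _ p).1 hnot
    rw [h1] at hl
    exact lt_irrefl _ hl
  exact congrArg vec h

theorem serMap_tpow (g : A →+* B) (v : LocallyConstant (PrimeSpectrum A) (Fin n → ℤ)) :
    serMap n g (tpow v) = tpow (pullback g v) := by
  ext l
  exact map_fiberIdem v g (vec l)

/-! ### Homomorphisms with given images of the variables -/

/-- A linear combination of homomorphisms of algebras by orthogonal idempotents with sum one. -/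
noncomputable def glueAlgHom {ι : Type*} [Fintype ι] (e : ι → A) (he : OrthogonalIdempotents e)
    (hsum : ∑ i, e i = 1) (φ : ι → Ser n A →A[A] Ser m A) : Ser n A →A[A] Ser m A where
  toAlgHom := AlgHom.ofLinearMap (∑ i, e i • (φ i : Ser n A →ₐ[A] Ser m A).toLinearMap)
    (by
      rw [LinearMap.sum_apply]
      simp only [LinearMap.smul_apply, AlgHom.toLinearMap_apply, map_one]
      rw [← Finset.sum_smul, hsum, one_smul])
    (by
      classical
      intro x y
      simp only [LinearMap.sum_apply, LinearMap.smul_apply, AlgHom.toLinearMap_apply, map_mul]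
      rw [Finset.sum_mul_sum]
      refine Finset.sum_congr rfl fun i _ => ?_
      simp only [smul_mul_smul_comm, he.mul_eq, ite_smul, zero_smul]
      rw [Finset.sum_ite_eq, if_pos (Finset.mem_univ i)])
  cont := by
    let Φ : Ser n A →ₗ[A] Ser m A := ∑ i, e i • (φ i : Ser n A →ₐ[A] Ser m A).toLinearMap
    refine (continuous_iff_contAtZero Φ.toAddMonoidHom).2 fun V hV => ?_
    choose W hW h using fun i => contAtZero_algHom (φ i) V hV
    refine ⟨⋃ i ∈ Finset.univ, W i, (Finset.isPWO_bUnion _).2 fun i _ => hW i,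
      fun f hf l hl => ?_⟩
    change (Φ f).coeff (-l) = 0
    simp only [Φ, LinearMap.sum_apply, HahnSeries.coeff_sum]
    refine Finset.sum_eq_zero fun i _ => ?_
    have h1 := h i f (fun w hw => hf w (Set.mem_biUnion (Finset.mem_coe.2 (Finset.mem_univ i)) hw))
      l hl
    change (e i • φ i f).coeff (-l) = 0
    rw [HahnSeries.coeff_smul, h1, smul_zero]

theorem glueAlgHom_apply {ι : Type*} [Fintype ι] (e : ι → A) (he : OrthogonalIdempotents e)
    (hsum : ∑ i, e i = 1) (φ : ι → Ser n A →A[A] Ser m A) (f : Ser n A) :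
    glueAlgHom e he hsum φ f = ∑ i, e i • φ i f := by
  change (∑ i, e i • (φ i : Ser n A →ₐ[A] Ser m A).toLinearMap) f = _
  rw [LinearMap.sum_apply]
  rfl

/-- The matrix with columns given by the valuations of invertible series. -/
noncomputable def nuMatrix (g : Fin n → (Ser m A)ˣ) :
    LocallyConstant (PrimeSpectrum A) (Matrix (Fin m) (Fin n) ℤ) where
  toFun p := Matrix.of fun j i => nu (g i) p j
  isLocallyConstant := by
    have h : IsLocallyConstant fun p : PrimeSpectrum A => fun i => nu (g i) p := by
      rw [IsLocallyConstant.iff_exists_open]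
      intro p
      have hU : ∀ i, IsOpen (nu (g i) ⁻¹' {nu (g i) p}) := fun i =>
        (nu (g i)).isLocallyConstant.isOpen_fiber _
      exact ⟨⋂ i, nu (g i) ⁻¹' {nu (g i) p}, isOpen_iInter_of_finite hU,
        Set.mem_iInter.2 fun _ => rfl, fun q hq => funext fun i => Set.mem_iInter.1 hq i⟩
    exact h.comp fun F => Matrix.of fun j i => F i j

/-- The constant-matrix construction is carried out over all of `A` for each of the finitely many
values of the matrix. Each resulting homomorphism has the right values only on its own part, and
idempotents select that part. -/
theorem exists_algHom (g : Fin n → (Ser m A)ˣ) (hg : ∀ p, nuMatrix g p ∈ MPlus m n) :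
    ∃ φ : Ser n A →A[A] Ser m A, ∀ i, φ (tvar A i) = g i := by
  let v := nuMatrix g
  have : Fintype (Set.range v) := v.range_finite.fintype
  let f : Fin n → (Ser m A)ˣ := fun i => g i * tpowUnit (-nu (g i))
  have hf : ∀ i, nu (f i) = 0 := fun i => by
    rw [nu_mul, nu_tpowUnit, add_neg_cancel]
  have hM : ∀ M : Set.range v, M.1 ∈ MPlus m n := by
    rintro ⟨_, p, rfl⟩
    exact hg p
  choose φ hφ using fun M : Set.range v => exists_algHom_of_matrix (hM M) f hf
  have hsum : ∑ M : Set.range v, fiberIdem v M.1 = 1 := by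
    rw [← sum_fiberIdem v (s := (Set.range v).toFinset) fun p => by simp]
    exact Finset.sum_subtype _ (fun x => by simp) _ |>.symm
  refine ⟨glueAlgHom (fun M : Set.range v => fiberIdem v M.1)
    ⟨fun M => fiberIdem_isIdempotentElem v _,
      fun M N h => fiberIdem_mul_of_ne v fun h' => h (Subtype.ext h')⟩ hsum φ, fun i => ?_⟩
  rw [glueAlgHom_apply]
  have h1 : ∀ M : Set.range v, fiberIdem v M.1 • φ M (tvar A i) =
      fiberIdem v M.1 • (g i : Ser m A) := by
    intro M
    rw [hφ, ← smul_mul_assoc]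
    have h2 := smul_tpow (nu (g i)) (x := fun j => M.1 j i)
      (fiberIdem_comp v (nu (g i)) (fun N j => N j i) (fun _ => rfl) M.1)
    rw [← h2, smul_mul_assoc]
    congr 1
    rw [← tpowUnit_val, ← Units.val_mul]
    simp only [f, tpowUnit_neg]
    rw [mul_comm (g i), mul_inv_cancel_left]
  rw [Finset.sum_congr rfl fun M _ => h1 M, ← Finset.sum_smul, hsum, one_smul]

end

section

variable {n m : ℕ} {A B : Type u} [CommRing A] [CommRing B]

/-! ### Base change -/

/-- The image of a variable, as an invertible series. -/
noncomputable def varImage (φ : Ser n A →A[A] Ser m A) (i : Fin n) : (Ser m A)ˣ :=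
  Units.map (φ : Ser n A →* Ser m A) (tvar A i)

theorem varImage_val (φ : Ser n A →A[A] Ser m A) (i : Fin n) :
    (varImage φ i : Ser m A) = φ (tvar A i) := rfl

theorem nuMatrix_varImage (φ : Ser n A →A[A] Ser m A) (p : PrimeSpectrum A) :
    nuMatrix (varImage φ) p ∈ MPlus m n :=
  upsilon_mem_MPlus φ p

theorem serMap_smul (g : A →+* B) (a : A) (f : Ser n A) :
    serMap n g (a • f) = g a • serMap n g f := by
  ext l
  rw [serMap_coeff, HahnSeries.coeff_smul, HahnSeries.coeff_smul, serMap_coeff, smul_eq_mul,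
    smul_eq_mul, map_mul]

theorem serMap_tvar (g : A →+* B) (i : Fin n) :
    serMap n g (tvar A i : Ser n A) = (tvar B i : Ser n B) := by
  ext l
  change g ((HahnSeries.single (vec.symm (Pi.single i 1)) (1 : A)).coeff l) =
    (HahnSeries.single (vec.symm (Pi.single i 1)) (1 : B)).coeff l
  by_cases h : l = vec.symm (Pi.single i 1)
  · rw [h, HahnSeries.coeff_single_same, HahnSeries.coeff_single_same, map_one]
  · rw [HahnSeries.coeff_single_of_ne h, HahnSeries.coeff_single_of_ne h, map_zero]

/-- The base-changed images of the variables have the pulled-back matrix, so they define a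
homomorphism over `B`. Compatibility and uniqueness both follow from comparison on the variables. -/
theorem hasBaseChange (n m : ℕ) : HasBaseChange.{u} n m := by
  intro A B g φ
  let G : Fin n → (Ser m B)ˣ := fun i =>
    Units.map (serMap m g.hom : Ser m A →* Ser m B) (varImage φ i)
  have hG : ∀ q, nuMatrix G q ∈ MPlus m n := by
    intro q
    have h : nuMatrix G q = nuMatrix (varImage φ) (PrimeSpectrum.comap g.hom q) := by
      ext j i
      exact congrFun (DFunLike.congr_fun (nu_serMap g.hom (varImage φ i)) q) j
    rw [h]
    exact nuMatrix_varImage φ _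
  obtain ⟨ψ, hψ⟩ := exists_algHom G hG
  refine ⟨ψ, fun f => ?_, fun χ hχ => algHom_ext_of_tvar fun i => ?_⟩
  · have hc₁ : ContAtZero (ψ ∘ serMap n g.hom) := (contAtZero_algHom ψ).comp (contAtZero_serMap _)
    have hc₂ : ContAtZero (serMap m g.hom ∘ φ) :=
      ContAtZero.comp (contAtZero_serMap g.hom) (contAtZero_algHom φ)
    have h := ringHom_ext_of_tvar (g := g.hom)
      (Φ := (ψ : Ser n B →+* Ser m B).comp (serMap n g.hom))
      (Ψ := (serMap m g.hom).comp (φ : Ser n A →+* Ser m A))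
      (fun a f => by
        change ψ (serMap n g.hom (a • f)) = _ • ψ (serMap n g.hom f)
        rw [serMap_smul, map_smul])
      (fun a f => by
        change serMap m g.hom (φ (a • f)) = _ • serMap m g.hom (φ f)
        rw [map_smul, serMap_smul])
      hc₁ hc₂
      (fun i => by
        change ψ (serMap n g.hom (tvar A i : Ser n A)) = serMap m g.hom (φ (tvar A i))
        rw [serMap_tvar, hψ]
        rfl)
    exact DFunLike.congr_fun h f
  · have h := hχ (tvar A i : Ser n A)
    rw [serMap_tvar] at h
    rw [h, hψ]
    rfl

/-! ### The isomorphism of functors -/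

/-- The pair that corresponds to a continuous homomorphism. -/
noncomputable def toTarget (φ : Ser n A →A[A] Ser m A) : PlusMatrix m n A × (Fin n → UnitsZero m A) :=
  (⟨upsilon φ, upsilon_mem_MPlus φ⟩, fun i => ⟨varImage φ i * tpowUnit (-nu (varImage φ i)), by
    rw [nu_mul, nu_tpowUnit, add_neg_cancel]⟩)

theorem toTarget_injective :
    Function.Injective (toTarget : (Ser n A →A[A] Ser m A) → _) := by
  intro φ ψ h
  refine algHom_ext_of_tvar fun i => ?_
  have hnu : nu (varImage φ i) = nu (varImage ψ i) := by
    ext p j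
    have h1 := congrArg (fun x => x.1.1 j i) h
    exact DFunLike.congr_fun h1 p
  have h2 : varImage φ i * tpowUnit (-nu (varImage φ i)) =
      varImage ψ i * tpowUnit (-nu (varImage ψ i)) := congrArg (fun x => (x.2 i).1) h
  rw [hnu] at h2
  exact congrArg Units.val (mul_right_cancel h2)

/-- A column of a matrix of locally constant functions. -/
noncomputable def plusColumn (M : Matrix (Fin m) (Fin n) (LocallyConstant (PrimeSpectrum A) ℤ))
    (i : Fin n) : LocallyConstant (PrimeSpectrum A) (Fin m → ℤ) where
  toFun p j := M j i p
  isLocallyConstant := by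
    rw [IsLocallyConstant.iff_exists_open]
    intro p
    exact ⟨⋂ j, M j i ⁻¹' {M j i p},
      isOpen_iInter_of_finite fun j => (M j i).isLocallyConstant.isOpen_fiber _,
      Set.mem_iInter.2 fun _ => rfl, fun q hq => funext fun j => Set.mem_iInter.1 hq j⟩

theorem toTarget_surjective :
    Function.Surjective (toTarget : (Ser n A →A[A] Ser m A) → _) := by
  rintro ⟨M, f⟩
  -- The prescribed images of the variables: since `f i` has trivial valuation, the column can be
  -- recovered as `ν(g i)`.
  let g : Fin n → (Ser m A)ˣ := fun i => (f i).1 * tpowUnit (plusColumn M.1 i)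
  have hnu : ∀ i, nu (g i) = plusColumn M.1 i := fun i => by
    rw [nu_mul, nu_tpowUnit, (f i).2, zero_add]
  obtain ⟨φ, hφ⟩ := exists_algHom g fun p => by
    have h : nuMatrix g p = M.1.map fun a => a p := by
      ext j i
      exact congrFun (DFunLike.congr_fun (hnu i) p) j
    rw [h]
    exact M.2 p
  have hvar : ∀ i, varImage φ i = g i := fun i => Units.ext (hφ i)
  refine ⟨φ, Prod.ext (Subtype.ext ?_) (funext fun i => Subtype.ext ?_)⟩
  · ext j i p
    have h1 : upsilon φ j i p = nu (varImage φ i) p j := rfl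
    change upsilon φ j i p = _
    rw [h1, hvar, hnu]
    rfl
  · change varImage φ i * tpowUnit (-nu (varImage φ i)) = _
    rw [hvar, hnu, tpowUnit_neg, mul_inv_cancel_right]

theorem toTarget_naturality {A B : CommRingCat.{u}} (g : A ⟶ B) (φ : Ser n A →A[A] Ser m A)
    (ψ : Ser n B →A[B] Ser m B) (h : ∀ f, ψ (serMap n g.hom f) = serMap m g.hom (φ f)) :
    toTarget ψ = (targetFunctor m n).map g (toTarget φ) := by
  have hvar : ∀ i, varImage ψ i =
      Units.map (serMap m g.hom : Ser m A →* Ser m B) (varImage φ i) := by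
    intro i
    ext1
    rw [varImage_val, ← serMap_tvar g.hom, h]
    rfl
  have hnu : ∀ i, nu (varImage ψ i) = pullback g.hom (nu (varImage φ i)) := fun i => by
    rw [hvar, nu_serMap]
  refine Prod.ext (Subtype.ext ?_) (funext fun i => Subtype.ext (Units.ext ?_))
  · ext j i p
    exact congrFun (DFunLike.congr_fun (hnu i) p) j
  · change (varImage ψ i : Ser m B) * tpow (-nu (varImage ψ i)) =
      serMap m g.hom ((varImage φ i : Ser m A) * tpow (-nu (varImage φ i)))
    rw [map_mul, serMap_tpow, hvar, nu_serMap]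
    rfl

/-- The isomorphism from the functor of continuous homomorphisms. -/
noncomputable def homIso (n m : ℕ) :
    homFunctor.{u} n m (hasBaseChange n m) ≅ targetFunctor.{u} m n :=
  NatIso.ofComponents
    (fun A => (Equiv.ofBijective (toTarget : (Ser n A →A[A] Ser m A) → _)
      ⟨toTarget_injective, toTarget_surjective⟩).toIso)
    fun {A B} g => by
      apply ConcreteCategory.hom_ext
      intro φ
      exact toTarget_naturality g φ _ (hasBaseChange n m A B g φ).choose_spec.1

end

section

/-! ### Recognizing ind-affine schemes -/

section Criterion

variable (F : CommRingCat.{u} ⥤ Type u) {S J : Type u} [Preorder J]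
  (ι : ∀ A : CommRingCat.{u}, F.obj A → S → A)
  (P : J → ∀ A : CommRingCat.{u}, F.obj A → Prop)

/-- The ideal of polynomials in the coordinates that vanish on a part of a functor. -/
def vanishingIdeal (j : J) : Ideal (MvPolynomial S ℤ) where
  carrier := {f | ∀ (A : CommRingCat.{u}) (x : F.obj A), P j A x → MvPolynomial.aeval (ι A x) f = 0}
  add_mem' hf hg A x hx := by rw [map_add, hf A x hx, hg A x hx, add_zero]
  zero_mem' A x _ := map_zero _
  smul_mem' c f hf A x hx := by rw [smul_eq_mul, map_mul, hf A x hx, mul_zero]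

variable {P}

theorem vanishingIdeal_antitone (hmono : ∀ i j, i ≤ j → ∀ A x, P i A x → P j A x) {i j : J}
    (hij : i ≤ j) : vanishingIdeal F ι P j ≤ vanishingIdeal F ι P i :=
  fun _ hf A x hx => hf A x (hmono i j hij A x hx)

/-- The system of quotients of a polynomial ring by vanishing ideals. -/
noncomputable def quotientSystem (hmono : ∀ i j, i ≤ j → ∀ A x, P i A x → P j A x) :
    J ⥤ CommRingCat.{u}ᵒᵖ where
  obj j := Opposite.op (CommRingCat.of (MvPolynomial S ℤ ⧸ vanishingIdeal F ι P j))
  map a := (CommRingCat.ofHom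
    (Ideal.Quotient.factor (vanishingIdeal_antitone F ι hmono (leOfHom a)))).op
  map_id j := by
    refine Quiver.Hom.unop_inj (CommRingCat.hom_ext (RingHom.ext fun x => ?_))
    obtain ⟨x, rfl⟩ := Ideal.Quotient.mk_surjective x
    rfl
  map_comp a b := by
    refine Quiver.Hom.unop_inj (CommRingCat.hom_ext (RingHom.ext fun x => ?_))
    obtain ⟨x, rfl⟩ := Ideal.Quotient.mk_surjective x
    rfl

/-- A functor is represented by an ind-affine scheme if it embeds into an affine space and is an
increasing union of parts such that all points at which the equations of a part hold belong to the
functor. -/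
theorem isIndAffine_of_vanishingIdeal [IsDirectedOrder J] [Nonempty J]
    (hmono : ∀ i j, i ≤ j → ∀ A x, P i A x → P j A x)
    (hexists : ∀ A x, ∃ j, P j A x)
    (hinj : ∀ A, Function.Injective (ι A))
    (hnat : ∀ (A B : CommRingCat.{u}) (g : A ⟶ B) (x : F.obj A) (s : S),
      ι B (F.map g x) s = g.hom (ι A x s))
    (hclosed : ∀ (j : J) (A : CommRingCat.{u}) (y : S → A),
      (∀ f ∈ vanishingIdeal F ι P j, MvPolynomial.aeval y f = 0) → ∃ x, ι A x = y) :
    IsIndAffine F := by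
  let R := quotientSystem F ι hmono
  refine ⟨J, inferInstance, inferInstance, inferInstance, R, fun i j a => ?_, ?_⟩
  · exact Ideal.Quotient.factor_surjective (vanishingIdeal_antitone F ι hmono (leOfHom a))
  let Q := fun j => MvPolynomial S ℤ ⧸ vanishingIdeal F ι P j
  let coord : ∀ j, S → Q j := fun j s => Ideal.Quotient.mk _ (MvPolynomial.X s)
  -- A homomorphism from the quotient gives a point of affine space satisfying the equations of the
  -- part `j`. The resulting `x` need not satisfy `P j`; membership in the functor is enough.
  have hpoint : ∀ j (A : CommRingCat.{u}) (h : Q j →+* A), ∃ x, ι A x = fun s => h (coord j s) := by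
    intro j A h
    refine hclosed j A _ fun f hf => ?_
    have e : ((MvPolynomial.aeval fun s => h (coord j s) : MvPolynomial S ℤ →ₐ[ℤ] A) :
        MvPolynomial S ℤ →+* A) = h.comp (Ideal.Quotient.mk _) :=
      MvPolynomial.ringHom_ext (fun a => by simp) fun s => by simp [coord]
    have e1 := DFunLike.congr_fun e f
    refine e1.trans ?_
    rw [RingHom.comp_apply, Ideal.Quotient.eq_zero_iff_mem.2 hf, map_zero]
  choose pt hpt using hpoint
  have hext : ∀ j (A : CommRingCat.{u}) (h h' : Q j →+* A), pt j A h = pt j A h' → h = h' := by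
    intro j A h h' e
    refine Ideal.Quotient.ringHom_ext (MvPolynomial.ringHom_ext (fun a => by simp) fun s => ?_)
    have := congrFun (congrArg (ι A) e) s
    rwa [hpt, hpt] at this
  have hlift : ∀ (A : CommRingCat.{u}) (x : F.obj A), ∃ j h, pt j A h = x := by
    intro A x
    obtain ⟨j, hj⟩ := hexists A x
    let h : Q j →+* A := Ideal.Quotient.lift _
      ((MvPolynomial.aeval (ι A x) : MvPolynomial S ℤ →ₐ[ℤ] A) : MvPolynomial S ℤ →+* A)
      fun f hf => hf A x hj
    refine ⟨j, h, hinj A ?_⟩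
    rw [hpt]
    funext s
    exact MvPolynomial.aeval_X (ι A x) s
  have hcomp : ∀ j (A B : CommRingCat.{u}) (h : Q j →+* A) (g : A ⟶ B),
      pt j B (g.hom.comp h) = F.map g (pt j A h) := by
    intro j A B h g
    refine hinj B (funext fun s => ?_)
    rw [hnat, hpt, hpt]
    rfl
  have hres : ∀ i j (hij : i ≤ j) (A : CommRingCat.{u}) (h : Q i →+* A),
      pt j A (h.comp (Ideal.Quotient.factor (vanishingIdeal_antitone F ι hmono hij))) =
        pt i A h := by
    intro i j hij A h
    refine hinj A (funext fun s => ?_)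
    rw [hpt, hpt]
    rfl
  let c : Limits.Cocone (R ⋙ coyoneda) :=
    { pt := F
      ι :=
        { app := fun j =>
            { app := fun A => TypeCat.ofHom fun h : CommRingCat.of (Q j) ⟶ A => pt j A h.hom
              naturality := fun A B g => by
                apply ConcreteCategory.hom_ext
                intro h
                exact hcomp j A B (h : CommRingCat.of (Q j) ⟶ A).hom g }
          naturality := fun i j a => by
            ext A h
            exact hres i j (leOfHom a) A (h : CommRingCat.of (Q i) ⟶ A).hom } }
  have hc : Limits.IsColimit c := by
    -- Colimits of functors are computed pointwise. For a directed system of sets it remains to see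
    -- that every element is reached (`hlift`) and that elements with equal image agree at a later
    -- stage (`hres`, `hext`).
    refine Limits.evaluationJointlyReflectsColimits c fun A => ?_
    refine Limits.Types.FilteredColimit.isColimitOf _ _ (fun x => ?_) fun i j xi xj h => ?_
    · obtain ⟨j, h, e⟩ := hlift A x
      exact ⟨j, CommRingCat.ofHom h, e.symm⟩
    · obtain ⟨k, hik, hjk⟩ := exists_ge_ge i j
      refine ⟨k, homOfLE hik, homOfLE hjk, ?_⟩
      apply CommRingCat.hom_ext
      apply hext k A
      have h1 := hres i k hik A (xi : CommRingCat.of (Q i) ⟶ A).hom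
      have h2 := hres j k hjk A (xj : CommRingCat.of (Q j) ⟶ A).hom
      exact h1.trans (Eq.trans h h2.symm)
  exact ⟨(Limits.colimit.isColimit _).coconePointUniqueUpToIso hc⟩

end Criterion

end

section

variable {n m : ℕ} {A : Type u} [CommRing A]

/-! ### Coordinates on the target functor -/

/-- A matrix of locally constant functions as a locally constant function. -/
noncomputable def plusLC (M : PlusMatrix m n A) :
    LocallyConstant (PrimeSpectrum A) (Matrix (Fin m) (Fin n) ℤ) where
  toFun p := M.1.map fun a => a p
  isLocallyConstant := by
    have h : IsLocallyConstant fun p : PrimeSpectrum A => fun i => plusColumn M.1 i p := by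
      rw [IsLocallyConstant.iff_exists_open]
      intro p
      exact ⟨⋂ i, plusColumn M.1 i ⁻¹' {plusColumn M.1 i p},
        isOpen_iInter_of_finite fun i => (plusColumn M.1 i).isLocallyConstant.isOpen_fiber _,
        Set.mem_iInter.2 fun _ => rfl, fun q hq => funext fun i => Set.mem_iInter.1 hq i⟩
    exact h.comp fun F => Matrix.of fun j i => F i j

/-- The coordinates: an idempotent for each constant matrix, and the coefficients of the series and
of their inverses. -/
abbrev Coord (m n : ℕ) : Type := MPlus m n ⊕ ((Fin n × Expo m) ⊕ (Fin n × Expo m))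

/-- The values of the coordinates. -/
noncomputable def coordValue (x : PlusMatrix m n A × (Fin n → UnitsZero m A)) : Coord m n → A
  | .inl N => fiberIdem (plusLC x.1) N.1
  | .inr (.inl (i, l)) => ((x.2 i).1 : Ser m A).coeff l
  | .inr (.inr (i, l)) => (((x.2 i).1⁻¹ : (Ser m A)ˣ) : Ser m A).coeff l

theorem coordValue_injective :
    Function.Injective (coordValue : PlusMatrix m n A × (Fin n → UnitsZero m A) → _) := by
  rintro ⟨M, f⟩ ⟨M', f'⟩ h
  refine Prod.ext (Subtype.ext ?_) (funext fun i => Subtype.ext (Units.ext ?_))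
  · ext j i p
    have h1 : fiberIdem (plusLC M) (plusLC M p) = fiberIdem (plusLC M') (plusLC M p) :=
      congrFun h (.inl ⟨plusLC M p, M.2 p⟩)
    have h2 := (fiberIdem_notMem_iff (plusLC M) _ p).2 rfl
    rw [h1, fiberIdem_notMem_iff] at h2
    exact congrFun (congrFun h2.symm j) i
  · ext l
    exact congrFun h (.inr (.inl (i, l)))

theorem coordValue_map {A B : CommRingCat.{u}} (g : A ⟶ B) (x : (targetFunctor m n).obj A)
    (s : Coord m n) :
    coordValue ((targetFunctor m n).map g x) s = g.hom (coordValue x s) := by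
  rcases s with N | ⟨i, l⟩ | ⟨i, l⟩
  · exact (map_fiberIdem (plusLC x.1) g.hom N.1).symm
  · rfl
  · rfl

/-- The indices of the parts of the target functor: a finite set of matrices, a bound for the
supports, and bounds for the nilpotency of the coefficients with negative exponents. -/
abbrev PartIndex (m n : ℕ) : Type := Finset (MPlus m n) × (Lam m)ᵒᵈ × (Expo m → ℕ)

/-- The part of the target functor with given bounds. -/
structure IsBounded (j : PartIndex m n) (x : PlusMatrix m n A × (Fin n → UnitsZero m A)) :
    Prop where
  matrix : ∀ p, ∃ N ∈ j.1, N.1 = plusLC x.1 p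
  support : ∀ i, ((x.2 i).1 : Ser m A).support ⊆ ZLam (OrderDual.ofDual j.2.1)
  support_inv : ∀ i,
    (((x.2 i).1⁻¹ : (Ser m A)ˣ) : Ser m A).support ⊆ ZLam (OrderDual.ofDual j.2.1)
  pow : ∀ i, ∀ l < 0, ((x.2 i).1 : Ser m A).coeff l ^ j.2.2 l = 0
  pow_inv : ∀ i, ∀ l < 0, (((x.2 i).1⁻¹ : (Ser m A)ˣ) : Ser m A).coeff l ^ j.2.2 l = 0

/-- Lowering the bounds enlarges the allowed support, which is why `PartIndex` uses the order dual
of `Lam m`. -/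
theorem ZLam_anti {lam mu : Lam m} (h : lam ≤ mu) : ZLam mu ⊆ ZLam lam :=
  fun _ hl p => (h p _).trans (hl p)

theorem IsBounded.mono {j j' : PartIndex m n} (h : j ≤ j')
    {x : PlusMatrix m n A × (Fin n → UnitsZero m A)} (hx : IsBounded j x) : IsBounded j' x where
  matrix p := by
    obtain ⟨N, hN, e⟩ := hx.matrix p
    exact ⟨N, h.1 hN, e⟩
  support i := (hx.support i).trans (ZLam_anti h.2.1)
  support_inv i := (hx.support_inv i).trans (ZLam_anti h.2.1)
  pow i l hl := pow_eq_zero_of_le (h.2.2 l) (hx.pow i l hl)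
  pow_inv i l hl := pow_eq_zero_of_le (h.2.2 l) (hx.pow_inv i l hl)

theorem isNilpotent_coeff_of_nu_eq_zero {f : (Ser m A)ˣ} (hf : nu f = 0) {l : Expo m}
    (hl : l < 0) : IsNilpotent ((f : Ser m A).coeff l) :=
  isNilpotent_iff_mem_prime.2 fun p => ((nu_eq_zero_iff f).1 hf p).1 l hl

theorem exists_isBounded (x : PlusMatrix m n A × (Fin n → UnitsZero m A)) :
    ∃ j, IsBounded j x := by
  classical
  let F : Finset (MPlus m n) :=
    ((plusLC x.1).range_finite.preimage Subtype.val_injective.injOn).toFinset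
  let W : Set (Expo m) := ⋃ i ∈ Finset.univ,
    (((x.2 i).1 : Ser m A).support ∪ (((x.2 i).1⁻¹ : (Ser m A)ˣ) : Ser m A).support)
  have hW : W.IsPWO := (Finset.isPWO_bUnion _).2 fun i _ =>
    (HahnSeries.isPWO_support _).union (HahnSeries.isPWO_support _)
  obtain ⟨lam, hlam⟩ := (isPWO_iff_exists_subset_ZLam W).1 hW
  have hsub : ∀ i, (((x.2 i).1 : Ser m A).support ∪
      (((x.2 i).1⁻¹ : (Ser m A)ˣ) : Ser m A).support) ⊆ ZLam lam := fun i =>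
    (Set.subset_biUnion_of_mem (u := fun i => (((x.2 i).1 : Ser m A).support ∪
      (((x.2 i).1⁻¹ : (Ser m A)ˣ) : Ser m A).support)) (Finset.mem_univ i)).trans hlam
  have h1 : ∀ i (l : Expo m), ∃ k, l < 0 → ((x.2 i).1 : Ser m A).coeff l ^ k = 0 := fun i l => by
    by_cases hl : l < 0
    · obtain ⟨k, hk⟩ := isNilpotent_coeff_of_nu_eq_zero (x.2 i).2 hl
      exact ⟨k, fun _ => hk⟩
    · exact ⟨0, fun h => absurd h hl⟩
  have h2 : ∀ i (l : Expo m), ∃ k, l < 0 →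
      (((x.2 i).1⁻¹ : (Ser m A)ˣ) : Ser m A).coeff l ^ k = 0 := fun i l => by
    by_cases hl : l < 0
    · obtain ⟨k, hk⟩ := isNilpotent_coeff_of_nu_eq_zero (nu_inv_eq_zero (x.2 i).2) hl
      exact ⟨k, fun _ => hk⟩
    · exact ⟨0, fun h => absurd h hl⟩
  choose K hK using h1
  choose K' hK' using h2
  -- One nilpotency exponent per `l` must serve all the series and their inverses; the sum over the
  -- finitely many `i` does.
  have hle : ∀ i l, K i l + K' i l ≤ ∑ i, (K i l + K' i l) := fun i l =>
    Finset.single_le_sum (f := fun i => K i l + K' i l) (fun _ _ => Nat.zero_le _)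
      (Finset.mem_univ i)
  refine ⟨(F, OrderDual.toDual lam, fun l => ∑ i, (K i l + K' i l)), fun p => ?_, fun i => ?_,
    fun i => ?_, fun i l hl => ?_, fun i l hl => ?_⟩
  · exact ⟨⟨plusLC x.1 p, x.1.2 p⟩, (Set.Finite.mem_toFinset _).2 ⟨p, rfl⟩, rfl⟩
  · exact Set.subset_union_left.trans (hsub i)
  · exact Set.subset_union_right.trans (hsub i)
  · exact pow_eq_zero_of_le ((Nat.le_add_right _ _).trans (hle i l)) (hK i l hl)
  · exact pow_eq_zero_of_le ((Nat.le_add_left _ _).trans (hle i l)) (hK' i l hl)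

/-! ### Points at which the equations hold -/

/-- The index set depends only on the bound `W`, so each coefficient of `f * f⁻¹ = 1` becomes one
polynomial equation valid on a whole part. -/
theorem coeff_mul_eq_sum {W : Set (Expo m)} (hW : W.IsPWO) {f g : Ser m A} (hf : f.support ⊆ W)
    (hg : g.support ⊆ W) (k : Expo m) :
    (f * g).coeff k = ∑ ab ∈ Finset.antidiagonal hW hW k, f.coeff ab.1 * g.coeff ab.2 := by
  rw [HahnSeries.coeff_mul]
  refine Finset.sum_subset (fun ab hab => ?_) fun ab hab hnot => ?_
  · rw [Finset.mem_antidiagonal] at hab ⊢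
    exact ⟨hf hab.1, hg hab.2.1, hab.2.2⟩
  · by_contra h
    refine hnot ?_
    rw [Finset.mem_antidiagonal] at hab ⊢
    exact ⟨left_ne_zero_of_mul h, right_ne_zero_of_mul h, hab.2.2⟩

theorem exists_unitsZero {W : Set (Expo m)} (hW : W.IsPWO) (a b : Expo m → A)
    (ha : ∀ l ∉ W, a l = 0) (hb : ∀ l ∉ W, b l = 0)
    (hab : ∀ k, ∑ p ∈ Finset.antidiagonal hW hW k, a p.1 * b p.2 = (1 : Ser m A).coeff k)
    (ha' : ∀ l < 0, IsNilpotent (a l)) (hb' : ∀ l < 0, IsNilpotent (b l)) :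
    ∃ f : UnitsZero m A, (f.1 : Ser m A).coeff = a ∧
      ((f.1⁻¹ : (Ser m A)ˣ) : Ser m A).coeff = b := by
  have ha2 : Function.support a ⊆ W := fun l hl => by
    by_contra h
    exact hl (ha l h)
  have hb2 : Function.support b ⊆ W := fun l hl => by
    by_contra h
    exact hl (hb l h)
  let f : Ser m A := ⟨a, hW.mono ha2⟩
  let g : Ser m A := ⟨b, hW.mono hb2⟩
  have hfg : f * g = 1 := by
    ext k
    rw [coeff_mul_eq_sum (f := f) (g := g) hW ha2 hb2]
    exact hab k
  let F : (Ser m A)ˣ := Units.mkOfMulEqOne f g hfg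
  have hF : nu F = 0 := by
    ext1 p
    -- Nilpotent coefficients at negative exponents make the valuations of `F` and `F⁻¹`
    -- non-negative; as they add up to zero, both vanish. This is why the inverses are among the
    -- coordinates.
    have hnonneg : ∀ G : (Ser m A)ˣ, (∀ l < 0, IsNilpotent ((G : Ser m A).coeff l)) →
        0 ≤ nuAt (G : Ser m A) p := by
      intro G hG
      by_contra! hlt
      exact ((nuAt_eq_iff G p _).1 rfl).2 (isNilpotent_iff_mem_prime.1 (hG _ hlt) p)
    have h1 := hnonneg F ha'
    have h2 := hnonneg F⁻¹ hb'
    have h3 : nuAt (F : Ser m A) p + nuAt ((F⁻¹ : (Ser m A)ˣ) : Ser m A) p = 0 := by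
      rw [← nuAt_mul, mul_inv_cancel, Units.val_one, nuAt, map_one, HahnSeries.order_one]
    exact congrArg vec ((add_eq_zero_iff_of_nonneg h1 h2).1 h3).1
  exact ⟨⟨F, hF⟩, rfl, rfl⟩

/-- Orthogonal idempotents with sum one define a locally constant function. -/
theorem exists_locallyConstant {X : Type} (s : Finset X) (e : X → A)
    (he : OrthogonalIdempotents e) (h0 : ∀ x ∉ s, e x = 0) (hsum : ∑ x ∈ s, e x = 1) :
    ∃ v : LocallyConstant (PrimeSpectrum A) X, (∀ p, v p ∈ s) ∧ ∀ x, fiberIdem v x = e x := by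
  have hex : ∀ p : PrimeSpectrum A, ∃ x, e x ∉ p.asIdeal := by
    intro p
    by_contra! h
    exact p.2.one_notMem (hsum ▸ p.asIdeal.sum_mem fun x _ => h x)
  have huniq : ∀ (p : PrimeSpectrum A) x y, e x ∉ p.asIdeal → e y ∉ p.asIdeal → x = y := by
    intro p x y hx hy
    by_contra hxy
    have h1 : e x * e y = 0 := he.ortho hxy
    exact p.2.mul_notMem hx hy (h1 ▸ p.asIdeal.zero_mem)
  choose v hv using hex
  let V : LocallyConstant (PrimeSpectrum A) X :=
    ⟨v, by
      rw [IsLocallyConstant.iff_exists_open]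
      exact fun p => ⟨PrimeSpectrum.basicOpen (e (v p)), TopologicalSpace.Opens.isOpen _, hv p,
        fun q hq => huniq q _ _ (hv q) hq⟩⟩
  refine ⟨V, fun p => ?_, fun x => (eq_fiberIdem V (he.idem x) fun p => ?_).symm⟩
  · by_contra h
    exact hv p (h0 _ h ▸ p.asIdeal.zero_mem)
  · exact ⟨fun h => huniq p _ _ (hv p) h, fun h => h ▸ hv p⟩

theorem exists_plusMatrix (F : Finset (MPlus m n)) (e : MPlus m n → A)
    (he : OrthogonalIdempotents e) (h0 : ∀ N ∉ F, e N = 0) (hsum : ∑ N ∈ F, e N = 1) :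
    ∃ M : PlusMatrix m n A, ∀ N : MPlus m n, fiberIdem (plusLC M) N.1 = e N := by
  obtain ⟨v, -, hv⟩ := exists_locallyConstant F e he h0 hsum
  refine ⟨⟨Matrix.of fun j i => v.map fun N => N.1 j i, fun p => (v p).2⟩, fun N => ?_⟩
  refine (eq_fiberIdem _ (he.idem N) fun p => ?_).symm
  rw [← hv N, fiberIdem_notMem_iff]
  exact Subtype.ext_iff

theorem isIndAffine_targetFunctor (m n : ℕ) : IsIndAffine (targetFunctor.{u} m n) := by
  classical
  refine isIndAffine_of_vanishingIdeal (targetFunctor.{u} m n) (S := ULift.{u} (Coord m n))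
    (J := ULift.{u} (PartIndex m n)) (fun A x s => coordValue x s.down)
    (P := fun j A x => IsBounded (A := A) j.down x) (fun i j hij A x hx => hx.mono hij)
    (fun A x => ?_) (fun A x y h => ?_) (fun A B g x s => coordValue_map g x s.down) ?_
  · obtain ⟨j, hj⟩ := exists_isBounded (A := A) x
    exact ⟨⟨j⟩, hj⟩
  · exact coordValue_injective (funext fun s => congrFun h ⟨s⟩)
  rintro ⟨F, lam, K⟩ A y hy
  let W := ZLam (OrderDual.ofDual lam)
  have hW : W.IsPWO := (isWF_ZLam _).isPWO
  let X : Coord m n → MvPolynomial (ULift.{u} (Coord m n)) ℤ := fun s => MvPolynomial.X ⟨s⟩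
  let z : Coord m n → A := fun s => y ⟨s⟩
  have hXy : ∀ s, MvPolynomial.aeval y (X s) = z s := fun s => MvPolynomial.aeval_X _ _
  have hX : ∀ (B : CommRingCat.{u}) (x : (targetFunctor.{u} m n).obj B) s, MvPolynomial.aeval
      (fun s : ULift.{u} (Coord m n) => coordValue x s.down) (X s) = coordValue x s :=
    fun B x s => MvPolynomial.aeval_X _ _
  have hsum1 : ∀ (B : CommRingCat.{u}) (x : (targetFunctor.{u} m n).obj B),
      IsBounded (A := B) (F, lam, K) x → ∑ N ∈ F, coordValue (A := B) x (.inl N) = 1 := by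
    intro B x hx
    have h1 : ∑ N ∈ F.map (Function.Embedding.subtype _), fiberIdem (plusLC (A := B) x.1) N = 1 :=
      sum_fiberIdem _ fun p => by
        obtain ⟨N, hN, e⟩ := hx.matrix p
        exact Finset.mem_map.2 ⟨N, hN, e⟩
    rwa [Finset.sum_map] at h1
  -- The method here and below is to exhibit explicit polynomials vanishing on the part and evaluate
  -- them at `y`. These say that the first coordinates are orthogonal idempotents, zero outside `F`,
  -- with sum `1`.
  obtain ⟨M, hM⟩ := exists_plusMatrix F (fun N => z (.inl N)) ⟨fun N => by
      have := hy (X (.inl N) * X (.inl N) - X (.inl N)) fun B x hx => by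
        rw [map_sub, map_mul, hX]
        exact sub_eq_zero.2 (fiberIdem_isIdempotentElem (plusLC (A := B) x.1) N.1)
      rw [map_sub, map_mul, hXy] at this
      exact sub_eq_zero.1 this, fun N N' hne => by
      have := hy (X (.inl N) * X (.inl N')) fun B x hx => by
        rw [map_mul, hX, hX]
        exact fiberIdem_mul_of_ne (plusLC (A := B) x.1) fun h => hne (Subtype.ext h)
      rwa [map_mul, hXy, hXy] at this⟩
    (fun N hN => by
      have := hy (X (.inl N)) fun B x hx => by
        rw [hX]
        refine fiberIdem_eq_zero (plusLC (A := B) x.1) fun p h => hN ?_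
        obtain ⟨N', hN', e⟩ := hx.matrix p
        rwa [← Subtype.ext (e.trans h)]
      rwa [hXy] at this)
    (by
      have := hy (∑ N ∈ F, X (.inl N) - 1) fun B x hx => by
        rw [map_sub, map_sum, map_one, sub_eq_zero, ← hsum1 B x hx]
        exact Finset.sum_congr rfl fun N _ => hX B x _
      rw [map_sub, map_sum, map_one, sub_eq_zero] at this
      rw [← this]
      exact Finset.sum_congr rfl fun N _ => (hXy _).symm)
  -- The equations used are vanishing outside `W`, the convolution identity for `f * f⁻¹ = 1`, and
  -- vanishing of the `K l`-th powers at negative exponents.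
  have hunits : ∀ i, ∃ f : UnitsZero m A, (f.1 : Ser m A).coeff = (fun l => z (.inr (.inl (i, l)))) ∧
      ((f.1⁻¹ : (Ser m A)ˣ) : Ser m A).coeff = fun l => z (.inr (.inr (i, l))) := by
    intro i
    refine exists_unitsZero hW _ _ (fun l hl => ?_) (fun l hl => ?_) (fun k => ?_) (fun l hl => ?_)
      fun l hl => ?_
    · have := hy (X (.inr (.inl (i, l)))) fun B x hx => by
        rw [hX]
        by_contra h
        exact hl (hx.support i h)
      rwa [hXy] at this
    · have := hy (X (.inr (.inr (i, l)))) fun B x hx => by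
        rw [hX]
        by_contra h
        exact hl (hx.support_inv i h)
      rwa [hXy] at this
    · have := hy (∑ p ∈ Finset.antidiagonal hW hW k,
          X (.inr (.inl (i, p.1))) * X (.inr (.inr (i, p.2))) - if k = 0 then 1 else 0)
        fun B x hx => by
          have h1 := coeff_mul_eq_sum hW (hx.support i) (hx.support_inv i) k
          rw [← Units.val_mul, mul_inv_cancel, Units.val_one, HahnSeries.coeff_one] at h1
          rw [map_sub, map_sum, sub_eq_zero]
          refine Eq.trans ?_ (h1.symm.trans ?_)
          · refine Finset.sum_congr rfl fun p _ => ?_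
            rw [map_mul, hX, hX]
            rfl
          · split_ifs
            · rw [map_one]
            · rw [map_zero]
      rw [map_sub, map_sum, sub_eq_zero] at this
      rw [HahnSeries.coeff_one]
      refine Eq.trans ?_ (this.trans ?_)
      · refine Finset.sum_congr rfl fun p _ => ?_
        rw [map_mul, hXy, hXy]
      · split_ifs
        · rw [map_one]
        · rw [map_zero]
    · refine ⟨K l, ?_⟩
      have := hy (X (.inr (.inl (i, l))) ^ K l) fun B x hx => by
        rw [map_pow, hX]
        exact hx.pow i l hl
      rwa [map_pow, hXy] at this
    · refine ⟨K l, ?_⟩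
      have := hy (X (.inr (.inr (i, l))) ^ K l) fun B x hx => by
        rw [map_pow, hX]
        exact hx.pow_inv i l hl
      rwa [map_pow, hXy] at this
  choose f hf hf' using hunits
  refine ⟨(M, f), funext fun s => ?_⟩
  obtain ⟨N | ⟨i, l⟩ | ⟨i, l⟩⟩ := s
  · exact hM N
  · exact congrFun (hf i) l
  · exact congrFun (hf' i) l

end

end IterLaurent

open IterLaurent

theorem mainTheorem5 (n m : ℕ) (hn : 1 ≤ n) (hm : 1 ≤ m) :
    IsIndAffine (targetFunctor.{u} m n) ∧
      ∃ h : HasBaseChange.{u} n m, ∃ e : homFunctor n m h ≅ targetFunctor m n,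
        ∀ (A : CommRingCat.{u}) (φ : Ser n A →A[A] Ser m A),
          ∃ (M : PlusMatrix m n A) (f : Fin n → UnitsZero m A),
            e.hom.app A φ = (M, f) ∧ M.1 = upsilon φ ∧
              ∀ i : Fin n, ((f i).1 : Ser m A) =
                φ (tvar A i) * tpow (-nu (Units.map (φ : Ser n A →* Ser m A) (tvar A i))) :=
  ⟨isIndAffine_targetFunctor m n, hasBaseChange n m, homIso n m, fun _ φ =>
    ⟨(toTarget φ).1, (toTarget φ).2, rfl, rfl, fun _ => rfl⟩⟩
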